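/- **Setting.** Let $K\ge 1$, $I=[0,1]^K$, $\ell$ Lebesgue measure, and $a\in(0,1)$. Let $(\theta_i,\boldsymbol\xi_i)$, $i\ge1$, be i.i.d. with $\theta_i\sim\mathrm{Bernoulli}(a)$ ($\theta_i=1$ meaning that the $i$-th null hypothesis $H_i$ is false), $\boldsymbol\xi_i\sim\mathrm{Unif}(I)$ given $\theta_i=0$, and $\boldsymbol\xi_i\sim G$ given $\theta_i=1$, where $G$ has a density $g\in C(I)$ with $g(\mathbf x)<g(\mathbf 0)<\infty$ for all $\mathbf x\in I\setminus\{\mathbf 0\}$. Suppose that for some $\varepsilon>0$ and $\gamma_1,\dots,\gamma_K>0$, $g(\mathbf x)=g(\mathbf 0)\bigl(1-\sum_k\gamma_kx_k^{\varepsilon}+o(|\mathbf x|^{\varepsilon})\bigr)$ as $\mathbf x\to\mathbf 0$ in $I$, and that $u\mapsto\ell(\{\mathbf x\in I:g(\mathbf x)\ge u\})$ is continuous on $[0,\infty)$. Put $\alpha_*=1/(1-a+a\,g(\mathbf 0))$. For a family $D=\{D_t\}_{0\le t\le 1}$ of Borel subsets of $I$ satisfying $$D_1=I,\qquad \ell(D_t)=t,\qquad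 D_s\subset D_t\ (s<t),\qquad D_t=\bigcap_{s>t}D_s\ (0\le t<1), \tag{1}$$ and $\alpha\in(0,1)$, the procedure based on $D$ applied to $H_1,\dots,H_n$ rejects $H_i$ if and only if $\boldsymbol\xi_i\in D_\tau$, where $\tau=\tau_n=\sup\{t\in[0,1]:t/\alpha\le (R(t)\vee1)/n\}$ and $R(t)=\#\{i\le n:\boldsymbol\xi_i\in D_t\}$. Its power is $E\bigl[\tfrac{R-V}{(n-N)\vee1}\bigr]$, where $R$ is the number of rejected nulls, $V$ that of rejected true nulls and $N$ that of true nulls; $\mathrm{Pow}(\alpha)$ denotes the limit of the power as $n\to\infty$. Let $\{D_{1t}\}$ be a family satisfying (1). Fix $\boldsymbol\nu$ with $\nu_k\ge0$ and $\sum_k\nu_k>0$, let $\Gamma_u(\boldsymbol\nu)=\{\mathbf x\in I:\sum_k\nu_kx_k^{\varepsilon}\le u\}$, and let $\{D_{2t}\}$ be its regularization: with $h(u)=\ell(\Gamma_u(\boldsymbol\nu))$ for $0\le u\le\sum_k\nu_k$, $D_{2t}=\Gamma_{h^{-1}(t)}(\boldsymbol\nu)$ for $0<t<1$, $D_{20}=\bigcap_u\Gamma_u(\boldsymbol\nu)$,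 $D_{21}=I$. Suppose that $G(D_{1t})$ and $G(D_{2t})$ are continuous in $t$, that there is $T\in(0,1)$ with $G(D_{1t})<G(D_{2t})$ for $0<t\le T$, and that, for every $\alpha>\alpha_*$ sufficiently close to $\alpha_*$ and $i=1,2$, the threshold $\tau_i$ of the procedure based on $\{D_{it}\}$ converges in probability, as $n\to\infty$, to some $t_i^*=t_i^*(\alpha)\in(0,T)$. **Proposition 4.3.** Assume that $t_1^*\to0$ as $\alpha\downarrow\alpha_*$, that $D_{1t}\downarrow\{\mathbf 0\}$ as $t\downarrow0$ (that is, $\bigcap_{t>0}D_{1t}=\{\mathbf 0\}$), and that $$\frac{g(\mathbf 0)t-G(D_{1t})}{g(\mathbf 0)t-G(D_{2t})}\longrightarrow M\in[1,\infty]\quad\text{as }t\downarrow0 .$$ Then for all $\alpha>\alpha_*$ sufficiently close to $\alpha_*$ the limits $\mathrm{Pow}_1(\alpha)$ and $\mathrm{Pow}_2(\alpha)$ of the powers of the procedures based on $\{D_{1t}\}$ and $\{D_{2t}\}$ exist, $\mathrm{Pow}_2(\alpha)>0$, and $$\frac{\mathrm{Pow}_1(\alpha)}{\mathrm{Pow}_2(\alpha)}\longrightarrow\left(\frac1M\right)^{K/\varepsilon}\quad\text{as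 }\alpha\downarrow\alpha_*$$ (the limit being $0$ if $M=\infty$). -/

import Mathlib

open MeasureTheory ProbabilityTheory Filter Topology Asymptotics
open scoped ENNReal

namespace MultiFDR

noncomputable section

/-- The unit cube `[0, 1]^K`, where multivariate p-values live. -/
def cube (K : ℕ) : Set (Fin K → ℝ) := Set.Icc 0 1

/-- The law on `[0, 1]^K` with density `g` with respect to Lebesgue measure
(the distribution of a p-value under a false null). -/
def densityLaw {K : ℕ} (g : (Fin K → ℝ) → ℝ) : Measure (Fin K → ℝ) :=
  (volume.restrict (cube K)).withDensity fun x => ENNReal.ofReal (g x)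

/-- The weighted sum `ν' x^ε = ∑ ν_k x_k^ε`. -/
def weightedSum {K : ℕ} (ν : Fin K → ℝ) (ε : ℝ) (x : Fin K → ℝ) : ℝ :=
  ∑ k, ν k * x k ^ ε

/-- Assumptions on the density `g` of the p-values under false nulls: `g` is a continuous
probability density on `[0, 1]^K`, with strict maximum at `0`, with the expansion
`g x = g 0 * (1 - γ' x^ε + o(|x|^ε))` at `0` for some `γ_k > 0`, and such that the
Lebesgue measure of `{g ≥ u}` depends continuously on `u ≥ 0`. -/
structure IsFalseNullDensity {K : ℕ} (g : (Fin K → ℝ) → ℝ) (γ : Fin K → ℝ) (ε : ℝ) :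
    Prop where
  continuousOn : ContinuousOn g (cube K)
  nonneg : ∀ x ∈ cube K, 0 ≤ g x
  integral_eq_one : ∫ x in cube K, g x = 1
  lt_zero_value : ∀ x ∈ cube K, x ≠ 0 → g x < g 0
  gamma_pos : ∀ k, 0 < γ k
  eps_pos : 0 < ε
  expansion : ∃ r : (Fin K → ℝ) → ℝ,
    (∀ x ∈ cube K, g x = g 0 * (1 - weightedSum γ ε x + r x)) ∧
    r =o[𝓝[cube K] 0] fun x => ‖x‖ ^ ε
  levels_continuous :
    ContinuousOn (fun u : ℝ => volume.real {x ∈ cube K | u ≤ g x}) (Set.Ici 0)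

/-- The random effects model: the pairs `(θ_i, ξ_i)` are i.i.d., the `i`-th null is false
(`θ_i = true`) with probability `a`, given a true null the coordinates of `ξ_i` are i.i.d.
uniform (i.e. `ξ_i` is uniform on the cube), and given a false null `ξ_i` has density `g`. -/
structure IsRandomEffectsModel {K : ℕ} {Ω : Type*} [MeasurableSpace Ω] (P : Measure Ω)
    (a : ℝ) (g : (Fin K → ℝ) → ℝ) (θ : ℕ → Ω → Bool) (ξ : ℕ → Ω → Fin K → ℝ) : Prop where
  measurable_theta : ∀ i, Measurable (θ i)
  measurable_xi : ∀ i, Measurable (ξ i)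
  indep : iIndepFun (fun i ω => (θ i ω, ξ i ω)) P
  prob_false_null : ∀ i, P (θ i ⁻¹' {true}) = ENNReal.ofReal a
  law_true_null : ∀ i, (P[|θ i ⁻¹' {false}]).map (ξ i) = volume.restrict (cube K)
  law_false_null : ∀ i, (P[|θ i ⁻¹' {true}]).map (ξ i) = densityLaw g

/-- Nested families of Borel regions `D_t ⊆ [0, 1]^K`, `0 ≤ t ≤ 1`, with `D_1 = [0, 1]^K`,
Lebesgue measure `t`, increasing and right-continuous in `t`. Values of `D` outside `[0, 1]`
are irrelevant. -/
structure IsNestedFamily {K : ℕ} (D : ℝ → Set (Fin K → ℝ)) : Prop where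
  measurableSet : ∀ t ∈ Set.Icc (0 : ℝ) 1, MeasurableSet (D t)
  subset_cube : ∀ t ∈ Set.Icc (0 : ℝ) 1, D t ⊆ cube K
  one_eq : D 1 = cube K
  volume_eq : ∀ t ∈ Set.Icc (0 : ℝ) 1, volume (D t) = ENNReal.ofReal t
  mono : ∀ s t : ℝ, 0 ≤ s → s < t → t ≤ 1 → D s ⊆ D t
  rightCont : ∀ t ∈ Set.Ico (0 : ℝ) 1, D t = ⋂ s ∈ Set.Ioc t 1, D s

/-- The regularization of an increasing family of regions `Γ_u`, `u ∈ I`: with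
`h u = ℓ (Γ_u)`, it is `Γ_{h⁻¹ t}` for `0 < t < 1`, the intersection of all the regions for
`t = 0`, and the whole cube for `t = 1`. -/
def regularization {K : ℕ} (I : Set ℝ) (Γ : ℝ → Set (Fin K → ℝ)) (t : ℝ) :
    Set (Fin K → ℝ) :=
  if t ≤ 0 then ⋂ u ∈ I, Γ u
  else if 1 ≤ t then cube K
  else Γ (Function.invFunOn (fun u => volume.real (Γ u)) I t)

/-- The region `Γ_u(ν) = {x ∈ [0, 1]^K : ν' x^ε ≤ u}`. -/
def ellRegion {K : ℕ} (ν : Fin K → ℝ) (ε u : ℝ) : Set (Fin K → ℝ) :=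
  {x ∈ cube K | weightedSum ν ε x ≤ u}

/-- The regularization of the regions `Γ_u(ν)`. The parameter `u` runs over
`[0, ∑ ν_k]`, on which the measure of `Γ_u(ν)` increases strictly from `0` to `1`. -/
def regularizedEll {K : ℕ} (ν : Fin K → ℝ) (ε : ℝ) : ℝ → Set (Fin K → ℝ) :=
  regularization (Set.Icc 0 (∑ k, ν k)) (ellRegion ν ε)

/-- `R(t)`: the number of `i < n` with `ξ_i ∈ D_t`. -/
def numRejected {K : ℕ} {Ω : Type*} (ξ : ℕ → Ω → Fin K → ℝ) (D : ℝ → Set (Fin K → ℝ))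
    (n : ℕ) (t : ℝ) (ω : Ω) : ℝ :=
  ∑ i ∈ Finset.range n, (D t).indicator (fun _ => (1 : ℝ)) (ξ i ω)

/-- `V(t)`: the number of `i < n` such that the `i`-th null is true and `ξ_i ∈ D_t`. -/
def numFalselyRejected {K : ℕ} {Ω : Type*} (θ : ℕ → Ω → Bool) (ξ : ℕ → Ω → Fin K → ℝ)
    (D : ℝ → Set (Fin K → ℝ)) (n : ℕ) (t : ℝ) (ω : Ω) : ℝ :=
  ∑ i ∈ Finset.range n,
    (if θ i ω then 0 else 1) * (D t).indicator (fun _ => (1 : ℝ)) (ξ i ω)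

/-- `N`: the number of true nulls among the first `n`. -/
def numTrueNulls {Ω : Type*} (θ : ℕ → Ω → Bool) (n : ℕ) (ω : Ω) : ℝ :=
  ∑ i ∈ Finset.range n, (if θ i ω then 0 else 1)

/-- The random threshold `τ = sup {t ∈ [0, 1] : t / α ≤ (R(t) ∨ 1) / n}` of the procedure
which, applied to `n` nulls, rejects the `i`-th one if and only if `ξ_i ∈ D_τ`. -/
def threshold {K : ℕ} {Ω : Type*} (ξ : ℕ → Ω → Fin K → ℝ) (D : ℝ → Set (Fin K → ℝ))
    (α : ℝ) (n : ℕ) (ω : Ω) : ℝ :=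
  sSup {t ∈ Set.Icc (0 : ℝ) 1 | t / α ≤ max (numRejected ξ D n t ω) 1 / n}

/-- The power `E[(R - V) / ((n - N) ∨ 1)]` of that procedure applied to `n` nulls. -/
def power {K : ℕ} {Ω : Type*} [MeasurableSpace Ω] (P : Measure Ω) (θ : ℕ → Ω → Bool)
    (ξ : ℕ → Ω → Fin K → ℝ) (D : ℝ → Set (Fin K → ℝ)) (α : ℝ) (n : ℕ) : ℝ :=
  ∫ ω, (numRejected ξ D n (threshold ξ D α n ω) ω
      - numFalselyRejected θ ξ D n (threshold ξ D α n ω) ω)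
    / max ((n : ℝ) - numTrueNulls θ n ω) 1 ∂P

/-- The critical level `α_* = 1 / (1 - a + a sup g)`, where `sup g = g 0`. -/
def alphaStar {K : ℕ} (a : ℝ) (g : (Fin K → ℝ) → ℝ) : ℝ := 1 / (1 - a + a * g 0)

end

end MultiFDR

/-! By the strong law, `R(t)/n` tends to `(1 - a) t + a G(D_t)`. At a threshold below 1 the defining
inequality is an equality, so a limit `t*` of the thresholds solves `t/α = (1 - a) t + a G(D_t)`
(`limit_threshold_eq`), and the power tends to `G(D_{t*})` (`tendsto_power`). Equivalently
`G(D_{t*}) = c(α) t*` with `c(α) = (1/α - (1 - a))/a`. This slope is the same for both families, so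
the ratio of the limiting powers is `t₁*/t₂*`.

As `α ↓ α_*`, `δ = g 0 - c(α)` decreases to `0`, and both limits satisfy `A_i(t_i*) = δ`, where
`A_i(t) = (g 0 * t - G(D_{it}))/t` is the deficit per unit volume. If all `ν_k > 0`, then for small
`t` the region `D_{2t}` is a dilate `s • B` of a fixed body, `t` is proportional to `s^K`, and the
expansion of `g` at `0` gives `A₂(t) ~ C t^(ε/K)` (`exists_tendsto_deficit`). Since `A₁/A₂ → M`,
comparing `A₁(t₁*) = A₂(t₂*)` yields `(t₁*/t₂*)^(ε/K) → 1/M` (`tendsto_ratio_of_power_law`).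

A vanishing weight is impossible: it would keep `A₂` above a positive constant
(`exists_mul_volume_le_deficit`), while `G(D₁) < G(D₂)` forces `A₂(t₁*) < A₁(t₁*) = δ → 0`. Finally
`t₂* → 0`, because the deficit of `D_{2t}` increases with `t` and is positive for `t > 0`, whereas
at `t₂*` it is less than `δ`. -/

namespace MultiFDR

/-! ### The threshold as a deterministic functional of a counting function -/

section Crossing

variable {φ : ℝ → ℝ} {α : ℝ}

lemma bddAbove_crossing (φ : ℝ → ℝ) (α : ℝ) :
    BddAbove {t ∈ Set.Icc (0 : ℝ) 1 | t / α ≤ φ t} :=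
  ⟨1, fun _ ht => ht.1.2⟩

/-- Monotonicity replaces continuity here: each crossing point `t` has `t ≤ α φ(t) ≤ α φ(sup)`, and
one takes the supremum over `t`. -/
lemma sSup_crossing_mem (hα : 0 < α) (hφ : MonotoneOn φ (Set.Icc 0 1)) (h0 : 0 ≤ φ 0) :
    sSup {t ∈ Set.Icc (0 : ℝ) 1 | t / α ≤ φ t} ∈ {t ∈ Set.Icc (0 : ℝ) 1 | t / α ≤ φ t} := by
  set S := {t ∈ Set.Icc (0 : ℝ) 1 | t / α ≤ φ t}
  have hS0 : (0 : ℝ) ∈ S := ⟨by simp, by simpa using h0⟩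
  have hbdd : BddAbove S := bddAbove_crossing φ α
  have hI : sSup S ∈ Set.Icc (0 : ℝ) 1 :=
    ⟨le_csSup hbdd hS0, csSup_le ⟨0, hS0⟩ fun _ ht => ht.1.2⟩
  refine ⟨hI, ?_⟩
  rw [div_le_iff₀ hα]
  refine csSup_le ⟨0, hS0⟩ fun t ht => ?_
  rw [← div_le_iff₀ hα]
  exact ht.2.trans (hφ ht.1 hI (le_csSup hbdd ht))

/-- If `τ < α φ(τ)`, a point slightly to the right of `τ` would still be a crossing point, since `φ`
does not decrease. The condition `τ < 1` leaves room for it. -/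
lemma sSup_crossing_eq (hα : 0 < α) (hφ : MonotoneOn φ (Set.Icc 0 1)) (h0 : 0 ≤ φ 0)
    (h1 : sSup {t ∈ Set.Icc (0 : ℝ) 1 | t / α ≤ φ t} < 1) :
    sSup {t ∈ Set.Icc (0 : ℝ) 1 | t / α ≤ φ t} / α =
      φ (sSup {t ∈ Set.Icc (0 : ℝ) 1 | t / α ≤ φ t}) := by
  have hmem := sSup_crossing_mem hα hφ h0
  have hlub : ∀ t ∈ {t ∈ Set.Icc (0 : ℝ) 1 | t / α ≤ φ t},
      t ≤ sSup {t ∈ Set.Icc (0 : ℝ) 1 | t / α ≤ φ t} :=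
    fun t ht => le_csSup (bddAbove_crossing φ α) ht
  set τ := sSup {t ∈ Set.Icc (0 : ℝ) 1 | t / α ≤ φ t}
  refine le_antisymm hmem.2 ?_
  rw [le_div_iff₀ hα]
  refine le_of_forall_gt_imp_ge_of_dense fun t ht => ?_
  by_contra! hlt
  set s := min t 1
  have hτs : τ < s := lt_min ht h1
  have hs : s ∈ Set.Icc (0 : ℝ) 1 := ⟨hmem.1.1.trans hτs.le, min_le_right _ _⟩
  refine absurd (hlub s ⟨hs, ?_⟩) (not_le.2 hτs)
  rw [div_le_iff₀ hα]
  calc s ≤ t := min_le_left _ _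
    _ ≤ φ τ * α := hlt.le
    _ ≤ φ s * α := by gcongr; exact hφ hmem.1 hs hτs.le

end Crossing

/-- If monotone functions converge at the rationals of `(0, 1)` to a function continuous at `t`,
then they converge along every sequence of arguments tending to `t`. -/
lemma tendsto_of_monotone_of_rat {R : ℕ → ℝ → ℝ} {F : ℝ → ℝ} {τ : ℕ → ℝ} {t : ℝ}
    (hR : ∀ n, MonotoneOn (R n) (Set.Icc 0 1)) (hτI : ∀ n, τ n ∈ Set.Icc (0 : ℝ) 1)
    (ht : t ∈ Set.Ioo (0 : ℝ) 1) (hF : ContinuousAt F t)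
    (hconv : ∀ q : ℚ, (q : ℝ) ∈ Set.Ioo (0 : ℝ) 1 →
      Tendsto (fun n => R n q) atTop (𝓝 (F q)))
    (hτ : Tendsto τ atTop (𝓝 t)) :
    Tendsto (fun n => R n (τ n)) atTop (𝓝 (F t)) := by
  have hI : Set.Ioo (0 : ℝ) 1 ∈ 𝓝 t := Ioo_mem_nhds ht.1 ht.2
  -- Squeeze: a rational `q` on one side of `t`, with `F q` still beyond `b`, is eventually on that
  -- same side of `τ n`, so monotonicity compares `R n q` with `R n (τ n)`.
  refine tendsto_order.2 ⟨fun b hb => ?_, fun b hb => ?_⟩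
  · have h := (hF.eventually (lt_mem_nhds hb)).and hI
    obtain ⟨l, hl, hlt⟩ := (mem_nhdsLT_iff_exists_Ioo_subset).1 (mem_nhdsWithin_of_mem_nhds h)
    obtain ⟨q, hq1, hq2⟩ := exists_rat_btwn (Set.mem_Iio.1 hl)
    obtain ⟨hqF, hqI⟩ := hlt ⟨hq1, hq2⟩
    filter_upwards [(hconv q hqI).eventually (lt_mem_nhds hqF), hτ.eventually (lt_mem_nhds hq2)]
      with n hn hn'
    exact hn.trans_le (hR n (Set.Ioo_subset_Icc_self hqI) (hτI n) hn'.le)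
  · have h := (hF.eventually (gt_mem_nhds hb)).and hI
    obtain ⟨l, hl, hlt⟩ := (mem_nhdsGT_iff_exists_Ioo_subset).1 (mem_nhdsWithin_of_mem_nhds h)
    obtain ⟨q, hq1, hq2⟩ := exists_rat_btwn (Set.mem_Ioi.1 hl)
    obtain ⟨hqF, hqI⟩ := hlt ⟨hq1, hq2⟩
    filter_upwards [(hconv q hqI).eventually (gt_mem_nhds hqF), hτ.eventually (gt_mem_nhds hq1)]
      with n hn hn'
    exact (hR n (hτI n) (Set.Ioo_subset_Icc_self hqI) hn'.le).trans_lt hn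

/-! ### The law of large numbers in the random effects model -/

section Model

variable {K : ℕ} {Ω : Type*} [MeasurableSpace Ω] {P : Measure Ω} [IsProbabilityMeasure P]
  {a : ℝ} {g : (Fin K → ℝ) → ℝ} {θ : ℕ → Ω → Bool} {ξ : ℕ → Ω → Fin K → ℝ}

omit [IsProbabilityMeasure P] in
lemma IsRandomEffectsModel.measurable_pair (h : IsRandomEffectsModel P a g θ ξ) (i : ℕ) :
    Measurable fun ω => (θ i ω, ξ i ω) :=
  (h.measurable_theta i).prodMk (h.measurable_xi i)

lemma IsRandomEffectsModel.prob_true_null (h : IsRandomEffectsModel P a g θ ξ) (ha : 0 ≤ a)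
    (i : ℕ) : P (θ i ⁻¹' {false}) = ENNReal.ofReal (1 - a) := by
  have hc : θ i ⁻¹' {false} = (θ i ⁻¹' {true})ᶜ := by ext ω; simp
  rw [hc, prob_compl_eq_one_sub (h.measurable_theta i (measurableSet_singleton _)),
    h.prob_false_null, ENNReal.ofReal_sub _ ha, ENNReal.ofReal_one]

lemma IsRandomEffectsModel.prob_false_null_inter (h : IsRandomEffectsModel P a g θ ξ) (i : ℕ)
    {s : Set (Fin K → ℝ)} (hs : MeasurableSet s) :
    P (θ i ⁻¹' {true} ∩ ξ i ⁻¹' s) = ENNReal.ofReal a * densityLaw g s := by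
  rw [← cond_mul_eq_inter (h.measurable_theta i (measurableSet_singleton _)),
    ← Measure.map_apply (h.measurable_xi i) hs, h.law_false_null, h.prob_false_null, mul_comm]

lemma IsRandomEffectsModel.prob_true_null_inter (h : IsRandomEffectsModel P a g θ ξ)
    (ha : 0 ≤ a) (i : ℕ) {s : Set (Fin K → ℝ)} (hs : MeasurableSet s) :
    P (θ i ⁻¹' {false} ∩ ξ i ⁻¹' s) =
      ENNReal.ofReal (1 - a) * volume.restrict (cube K) s := by
  rw [← cond_mul_eq_inter (h.measurable_theta i (measurableSet_singleton _)),
    ← Measure.map_apply (h.measurable_xi i) hs, h.law_true_null, h.prob_true_null ha, mul_comm]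

/-- The joint law is the mixture of the two conditional laws. It does not depend on `i`, which gives
the identical distribution needed for the strong law. -/
lemma IsRandomEffectsModel.prob_pair (h : IsRandomEffectsModel P a g θ ξ) (ha : 0 ≤ a) (i : ℕ)
    {S : Set (Bool × (Fin K → ℝ))} (hS : MeasurableSet S) :
    P ((fun ω => (θ i ω, ξ i ω)) ⁻¹' S) =
      ENNReal.ofReal a * densityLaw g (Prod.mk true ⁻¹' S) +
        ENNReal.ofReal (1 - a) * volume.restrict (cube K) (Prod.mk false ⁻¹' S) := by
  have ht : MeasurableSet (Prod.mk true ⁻¹' S) := measurable_prodMk_left hS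
  have hf : MeasurableSet (Prod.mk false ⁻¹' S) := measurable_prodMk_left hS
  have hsplit : (fun ω => (θ i ω, ξ i ω)) ⁻¹' S =
      (θ i ⁻¹' {true} ∩ ξ i ⁻¹' (Prod.mk true ⁻¹' S)) ∪
        (θ i ⁻¹' {false} ∩ ξ i ⁻¹' (Prod.mk false ⁻¹' S)) := by
    ext ω
    cases hω : θ i ω <;> simp [hω]
  rw [hsplit, measure_union, h.prob_false_null_inter i ht, h.prob_true_null_inter ha i hf]
  · refine Set.disjoint_left.2 fun ω h1 h2 => ?_
    have e1 : θ i ω = true := h1.1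
    have e2 : θ i ω = false := h2.1
    simp [e1] at e2
  · exact (h.measurable_theta i (measurableSet_singleton _)).inter (h.measurable_xi i hf)

lemma IsRandomEffectsModel.identDistrib_pair (h : IsRandomEffectsModel P a g θ ξ) (ha : 0 ≤ a)
    (i : ℕ) : IdentDistrib (fun ω => (θ i ω, ξ i ω)) (fun ω => (θ 0 ω, ξ 0 ω)) P P where
  aemeasurable_fst := (h.measurable_pair i).aemeasurable
  aemeasurable_snd := (h.measurable_pair 0).aemeasurable
  map_eq := by
    ext S hS
    rw [Measure.map_apply (h.measurable_pair i) hS, Measure.map_apply (h.measurable_pair 0) hS,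
      h.prob_pair ha i hS, h.prob_pair ha 0 hS]

/-- The empirical frequencies of the pairs `(θ_i, ξ_i)` converge almost surely. -/
lemma IsRandomEffectsModel.tendsto_frequency (h : IsRandomEffectsModel P a g θ ξ) (ha : 0 ≤ a)
    {S : Set (Bool × (Fin K → ℝ))} (hS : MeasurableSet S) :
    ∀ᵐ ω ∂P, Tendsto (fun n : ℕ =>
        (∑ i ∈ Finset.range n, S.indicator (fun _ => (1 : ℝ)) (θ i ω, ξ i ω)) / n) atTop
      (𝓝 (P.real ((fun ω => (θ 0 ω, ξ 0 ω)) ⁻¹' S))) := by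
  have hf : Measurable (S.indicator fun _ => (1 : ℝ)) := measurable_const.indicator hS
  have key := strong_law_ae_real (μ := P)
    (fun i ω => S.indicator (fun _ => (1 : ℝ)) (θ i ω, ξ i ω)) ?_ ?_ ?_
  · have hint : ∫ ω, S.indicator (fun _ => (1 : ℝ)) (θ 0 ω, ξ 0 ω) ∂P =
        P.real ((fun ω => (θ 0 ω, ξ 0 ω)) ⁻¹' S) :=
      integral_indicator_one (h.measurable_pair 0 hS)
    rwa [hint] at key
  · exact (integrable_const (1 : ℝ)).indicator (h.measurable_pair 0 hS)
  · intro i j hij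
    exact (h.indep.indepFun hij).comp hf hf
  · intro i
    exact (h.identDistrib_pair ha i).comp hf

end Model

end MultiFDR

namespace MultiFDR

/-! ### Measurability of the threshold -/

section Threshold

variable {K : ℕ} {Ω : Type*} {θ : ℕ → Ω → Bool} {ξ : ℕ → Ω → Fin K → ℝ}
  {D : ℝ → Set (Fin K → ℝ)} {α : ℝ}

/-- The number of `i < n` such that the `i`-th null is false and `ξ_i ∈ D_t`. -/
noncomputable def numTrulyRejected (θ : ℕ → Ω → Bool) (ξ : ℕ → Ω → Fin K → ℝ)
    (D : ℝ → Set (Fin K → ℝ)) (n : ℕ) (t : ℝ) (ω : Ω) : ℝ :=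
  ∑ i ∈ Finset.range n,
    (({true} : Set Bool) ×ˢ D t).indicator (fun _ => (1 : ℝ)) (θ i ω, ξ i ω)

lemma numRejected_sub_numFalselyRejected (n : ℕ) (t : ℝ) (ω : Ω) :
    numRejected ξ D n t ω - numFalselyRejected θ ξ D n t ω = numTrulyRejected θ ξ D n t ω := by
  classical
  simp only [numRejected, numFalselyRejected, numTrulyRejected, ← Finset.sum_sub_distrib]
  refine Finset.sum_congr rfl fun i _ => ?_
  by_cases h : ξ i ω ∈ D t <;> cases hθ : θ i ω <;> simp [h, Set.indicator]

/-- All counts are written as frequencies of the pairs `(θ_i, ξ_i)` in a set, so that a single law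
of large numbers covers them. -/
lemma numRejected_eq_sum_pair (n : ℕ) (t : ℝ) (ω : Ω) :
    numRejected ξ D n t ω = ∑ i ∈ Finset.range n,
      ((Set.univ : Set Bool) ×ˢ D t).indicator (fun _ => (1 : ℝ)) (θ i ω, ξ i ω) := by
  classical
  refine Finset.sum_congr rfl fun i _ => ?_
  by_cases h : ξ i ω ∈ D t <;> simp [h, Set.indicator]

lemma natCast_sub_numTrueNulls (n : ℕ) (ω : Ω) :
    (n : ℝ) - numTrueNulls θ n ω = ∑ i ∈ Finset.range n,
      (({true} : Set Bool) ×ˢ (Set.univ : Set (Fin K → ℝ))).indicator (fun _ => (1 : ℝ))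
        (θ i ω, ξ i ω) := by
  classical
  have hn : (n : ℝ) = ∑ i ∈ Finset.range n, (1 : ℝ) := by simp
  rw [numTrueNulls, hn, ← Finset.sum_sub_distrib]
  refine Finset.sum_congr rfl fun i _ => ?_
  cases hθ : θ i ω <;> simp [Set.indicator]

lemma numRejected_monotoneOn (hmono : MonotoneOn D (Set.Icc 0 1)) (n : ℕ) (ω : Ω) :
    MonotoneOn (fun t => numRejected ξ D n t ω) (Set.Icc 0 1) := fun _ hs _ ht hst =>
  Finset.sum_le_sum fun _ _ =>
    Set.indicator_le_indicator_of_subset (hmono hs ht hst) (fun _ => zero_le_one) _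

lemma numTrulyRejected_monotoneOn (hmono : MonotoneOn D (Set.Icc 0 1)) (n : ℕ) (ω : Ω) :
    MonotoneOn (fun t => numTrulyRejected θ ξ D n t ω) (Set.Icc 0 1) := fun _ hs _ ht hst =>
  Finset.sum_le_sum fun _ _ => Set.indicator_le_indicator_of_subset
    (Set.prod_mono subset_rfl (hmono hs ht hst)) (fun _ => zero_le_one) _

lemma numTrulyRejected_nonneg (n : ℕ) (t : ℝ) (ω : Ω) : 0 ≤ numTrulyRejected θ ξ D n t ω :=
  Finset.sum_nonneg fun _ _ => Set.indicator_nonneg (fun _ _ => zero_le_one) _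

lemma numTrulyRejected_le (n : ℕ) (t : ℝ) (ω : Ω) :
    numTrulyRejected θ ξ D n t ω ≤ n - numTrueNulls θ n ω := by
  rw [natCast_sub_numTrueNulls (ξ := ξ)]
  exact Finset.sum_le_sum fun _ _ => Set.indicator_le_indicator_of_subset
    (Set.prod_mono subset_rfl (Set.subset_univ _)) (fun _ => zero_le_one) _

lemma exists_nat_numRejected (n : ℕ) (t : ℝ) (ω : Ω) : ∃ k : ℕ, numRejected ξ D n t ω = k := by
  classical
  refine ⟨∑ i ∈ Finset.range n, (D t).indicator (fun _ => 1) (ξ i ω), ?_⟩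
  rw [numRejected, Nat.cast_sum]
  refine Finset.sum_congr rfl fun i _ => ?_
  by_cases h : ξ i ω ∈ D t <;> simp [h]

lemma crossing_monotoneOn (hmono : MonotoneOn D (Set.Icc 0 1)) (n : ℕ) (ω : Ω) :
    MonotoneOn (fun t => max (numRejected ξ D n t ω) 1 / n) (Set.Icc 0 1) := by
  intro s hs t ht hst
  have := numRejected_monotoneOn (ξ := ξ) hmono n ω hs ht hst
  dsimp only at this ⊢
  gcongr

lemma crossing_nonneg (n : ℕ) (t : ℝ) (ω : Ω) : 0 ≤ max (numRejected ξ D n t ω) 1 / n := by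
  positivity

lemma threshold_mem (hα : 0 < α) (hmono : MonotoneOn D (Set.Icc 0 1)) (n : ℕ) (ω : Ω) :
    threshold ξ D α n ω ∈
      {t ∈ Set.Icc (0 : ℝ) 1 | t / α ≤ max (numRejected ξ D n t ω) 1 / n} :=
  sSup_crossing_mem hα (crossing_monotoneOn hmono n ω) (crossing_nonneg n 0 ω)

lemma threshold_div_eq (hα : 0 < α) (hmono : MonotoneOn D (Set.Icc 0 1)) (n : ℕ) (ω : Ω)
    (h1 : threshold ξ D α n ω < 1) :
    threshold ξ D α n ω / α = max (numRejected ξ D n (threshold ξ D α n ω) ω) 1 / n :=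
  sSup_crossing_eq hα (crossing_monotoneOn hmono n ω) (crossing_nonneg n 0 ω) h1

/-- A countable set that contains all the values of the threshold. -/
def thresholdValues (α : ℝ) (n : ℕ) : Set ℝ :=
  insert 1 (Set.range fun k : ℕ => α * (max (k : ℝ) 1 / n))

lemma countable_thresholdValues (α : ℝ) (n : ℕ) : (thresholdValues α n).Countable :=
  (Set.countable_range _).insert _

lemma threshold_mem_values (hα : 0 < α) (hmono : MonotoneOn D (Set.Icc 0 1)) (n : ℕ) (ω : Ω) :
    threshold ξ D α n ω ∈ thresholdValues α n := by
  rcases (threshold_mem (ξ := ξ) hα hmono n ω).1.2.lt_or_eq with h | h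
  · obtain ⟨k, hk⟩ := exists_nat_numRejected (ξ := ξ) (D := D) n (threshold ξ D α n ω) ω
    refine Or.inr ⟨k, ?_⟩
    have := threshold_div_eq hα hmono n ω h
    rw [hk] at this
    simp only [← this]
    field_simp
  · exact Or.inl h

variable [MeasurableSpace Ω]

lemma measurable_numRejected (hξ : ∀ i, Measurable (ξ i)) (n : ℕ) {t : ℝ}
    (ht : MeasurableSet (D t)) : Measurable (numRejected ξ D n t) :=
  Finset.measurable_fun_sum _ fun i _ => (measurable_const.indicator ht).comp (hξ i)

lemma measurable_numTrulyRejected (hθ : ∀ i, Measurable (θ i)) (hξ : ∀ i, Measurable (ξ i))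
    (n : ℕ) {t : ℝ} (ht : MeasurableSet (D t)) : Measurable (numTrulyRejected θ ξ D n t) :=
  Finset.measurable_fun_sum _ fun i _ =>
    (measurable_const.indicator ((measurableSet_singleton true).prod ht)).comp
      ((hθ i).prodMk (hξ i))

/-- The threshold is a supremum over uncountably many `t`, but it is either `1` or `α (R ∨ 1)/n`
with `R` an integer. Only countably many candidates need testing. -/
lemma measurable_threshold (hξ : ∀ i, Measurable (ξ i)) (hα : 0 < α)
    (hmeas : ∀ t ∈ Set.Icc (0 : ℝ) 1, MeasurableSet (D t))
    (hmono : MonotoneOn D (Set.Icc 0 1)) (n : ℕ) : Measurable (threshold ξ D α n) := by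
  refine measurable_of_Ici fun c => ?_
  have heq : threshold ξ D α n ⁻¹' Set.Ici c =
      ⋃ v ∈ thresholdValues α n ∩ (Set.Icc 0 1 ∩ Set.Ici c),
        {ω | v / α ≤ max (numRejected ξ D n v ω) 1 / n} := by
    ext ω
    simp only [Set.mem_preimage, Set.mem_Ici, Set.mem_iUnion, Set.mem_ofPred_eq, exists_prop]
    constructor
    · intro h
      have hm := threshold_mem (ξ := ξ) hα hmono n ω
      exact ⟨_, ⟨threshold_mem_values hα hmono n ω, hm.1, h⟩, hm.2⟩
    · rintro ⟨v, ⟨-, hvI, hvc⟩, hv⟩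
      exact le_trans hvc (le_csSup (bddAbove_crossing _ α) ⟨hvI, hv⟩)
  rw [heq]
  refine MeasurableSet.biUnion ((countable_thresholdValues α n).mono Set.inter_subset_left)
    fun v hv => measurableSet_le measurable_const ?_
  exact ((measurable_numRejected hξ n (hmeas v hv.2.1)).max measurable_const).div_const _

/-- The count is evaluated at a random `t`, so the event is split according to the countably many
values of the threshold. -/
lemma measurable_numTrulyRejected_threshold (hθ : ∀ i, Measurable (θ i))
    (hξ : ∀ i, Measurable (ξ i)) (hα : 0 < α)
    (hmeas : ∀ t ∈ Set.Icc (0 : ℝ) 1, MeasurableSet (D t))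
    (hmono : MonotoneOn D (Set.Icc 0 1)) (n : ℕ) :
    Measurable fun ω => numTrulyRejected θ ξ D n (threshold ξ D α n ω) ω := by
  intro s hs
  have heq : (fun ω => numTrulyRejected θ ξ D n (threshold ξ D α n ω) ω) ⁻¹' s =
      ⋃ v ∈ thresholdValues α n ∩ Set.Icc 0 1,
        threshold ξ D α n ⁻¹' {v} ∩ numTrulyRejected θ ξ D n v ⁻¹' s := by
    ext ω
    simp only [Set.mem_preimage, Set.mem_iUnion, Set.mem_inter_iff, Set.mem_singleton_iff,
      exists_prop]
    constructor
    · intro h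
      exact ⟨_, ⟨threshold_mem_values hα hmono n ω, (threshold_mem hα hmono n ω).1⟩, rfl, h⟩
    · rintro ⟨v, -, rfl, h⟩
      exact h
  rw [heq]
  refine MeasurableSet.biUnion ((countable_thresholdValues α n).mono Set.inter_subset_left)
    fun v hv => ?_
  exact (measurable_threshold hξ hα hmeas hmono n (measurableSet_singleton v)).inter
    (measurable_numTrulyRejected hθ hξ n (hmeas v hv.2) hs)

lemma measurable_numTrueNulls (hθ : ∀ i, Measurable (θ i)) (n : ℕ) :
    Measurable (numTrueNulls θ n) :=
  Finset.measurable_fun_sum _ fun i _ =>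
    (Measurable.of_discrete (f := fun b : Bool => if b then (0 : ℝ) else 1)).comp (hθ i)

end Threshold

/-! ### Limits of the threshold and of the power -/

section Limit

variable {K : ℕ} {Ω : Type*} [MeasurableSpace Ω] {P : Measure Ω} [IsProbabilityMeasure P]
  {a : ℝ} {g : (Fin K → ℝ) → ℝ} {θ : ℕ → Ω → Bool} {ξ : ℕ → Ω → Fin K → ℝ}
  {D : ℝ → Set (Fin K → ℝ)} {α t : ℝ}

lemma IsRandomEffectsModel.prob_truly_rejected (h : IsRandomEffectsModel P a g θ ξ)
    (ha : a ∈ Set.Ioo (0 : ℝ) 1) {s : Set (Fin K → ℝ)} (hs : MeasurableSet s) :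
    P.real ((fun ω => (θ 0 ω, ξ 0 ω)) ⁻¹' (({true} : Set Bool) ×ˢ s)) =
      a * (densityLaw g).real s := by
  rw [measureReal_def, h.prob_pair ha.1.le 0 ((measurableSet_singleton true).prod hs)]
  have h1 : Prod.mk true ⁻¹' (({true} : Set Bool) ×ˢ s) = s := by ext; simp
  have h2 : Prod.mk false ⁻¹' (({true} : Set Bool) ×ˢ s) = ∅ := by ext; simp
  rw [h1, h2, measure_empty, mul_zero, add_zero, ENNReal.toReal_mul,
    ENNReal.toReal_ofReal ha.1.le, measureReal_def]

lemma IsRandomEffectsModel.isProbabilityMeasure_densityLaw (h : IsRandomEffectsModel P a g θ ξ)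
    (ha : a ∈ Set.Ioo (0 : ℝ) 1) : IsProbabilityMeasure (densityLaw g) := by
  have hne : P (θ 0 ⁻¹' {true}) ≠ 0 := by
    rw [h.prob_false_null]; simpa using ha.1
  have := cond_isProbabilityMeasure hne
  rw [← h.law_false_null 0]
  exact Measure.isProbabilityMeasure_map (h.measurable_xi 0).aemeasurable

lemma IsRandomEffectsModel.prob_rejected (h : IsRandomEffectsModel P a g θ ξ)
    (ha : a ∈ Set.Ioo (0 : ℝ) 1) {s : Set (Fin K → ℝ)} (hs : MeasurableSet s)
    (hsub : s ⊆ cube K) (ht : 0 ≤ t) (hvol : volume s = ENNReal.ofReal t) :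
    P.real ((fun ω => (θ 0 ω, ξ 0 ω)) ⁻¹' ((Set.univ : Set Bool) ×ˢ s)) =
      (1 - a) * t + a * (densityLaw g).real s := by
  have := h.isProbabilityMeasure_densityLaw ha
  rw [measureReal_def, h.prob_pair ha.1.le 0 (MeasurableSet.univ.prod hs)]
  have h1 : ∀ b : Bool, Prod.mk b ⁻¹' ((Set.univ : Set Bool) ×ˢ s) = s := by
    intro b; ext; simp
  rw [h1, h1, Measure.restrict_apply hs, Set.inter_eq_left.2 hsub, hvol, ENNReal.toReal_add
    (ENNReal.mul_ne_top ENNReal.ofReal_ne_top (measure_ne_top _ _))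
    (ENNReal.mul_ne_top ENNReal.ofReal_ne_top ENNReal.ofReal_ne_top), ENNReal.toReal_mul,
    ENNReal.toReal_mul, ENNReal.toReal_ofReal ha.1.le,
    ENNReal.toReal_ofReal (sub_nonneg.2 ha.2.le), ENNReal.toReal_ofReal ht, measureReal_def,
    add_comm]

/-- Almost sure convergence, along a subsequence on which the thresholds converge, of the
normalized numbers of rejections, true rejections and false nulls. -/
lemma IsRandomEffectsModel.ae_tendsto_counts (h : IsRandomEffectsModel P a g θ ξ)
    (ha : a ∈ Set.Ioo (0 : ℝ) 1) (hα : 0 < α)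
    (hmeas : ∀ t ∈ Set.Icc (0 : ℝ) 1, MeasurableSet (D t))
    (hsub : ∀ t ∈ Set.Icc (0 : ℝ) 1, D t ⊆ cube K)
    (hvol : ∀ t ∈ Set.Icc (0 : ℝ) 1, volume (D t) = ENNReal.ofReal t)
    (hmono : MonotoneOn D (Set.Icc 0 1))
    (hcont : ContinuousOn (fun t => (densityLaw g).real (D t)) (Set.Icc 0 1))
    (ht : t ∈ Set.Ioo (0 : ℝ) 1) {ns : ℕ → ℕ} (hns : Tendsto ns atTop atTop)
    (hτ : ∀ᵐ ω ∂P, Tendsto (fun k => threshold ξ D α (ns k) ω) atTop (𝓝 t)) :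
    ∀ᵐ ω ∂P,
      Tendsto (fun k => numRejected ξ D (ns k) (threshold ξ D α (ns k) ω) ω / ns k) atTop
        (𝓝 ((1 - a) * t + a * (densityLaw g).real (D t))) ∧
      Tendsto (fun k => numTrulyRejected θ ξ D (ns k) (threshold ξ D α (ns k) ω) ω / ns k) atTop
        (𝓝 (a * (densityLaw g).real (D t))) ∧
      Tendsto (fun k => ((ns k : ℝ) - numTrueNulls θ (ns k) ω) / ns k) atTop (𝓝 a) := by
  have hprob := h.isProbabilityMeasure_densityLaw ha
  -- Restricting to rational `q` gives one exceptional null set for all of them; monotonicity in `t`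
  -- fills in the rest.
  have hR : ∀ᵐ ω ∂P, ∀ q : ℚ, (q : ℝ) ∈ Set.Ioo (0 : ℝ) 1 →
      Tendsto (fun n : ℕ => numRejected ξ D n q ω / n) atTop
        (𝓝 ((1 - a) * q + a * (densityLaw g).real (D q))) := by
    refine ae_all_iff.2 fun q => ?_
    by_cases hq : (q : ℝ) ∈ Set.Ioo (0 : ℝ) 1
    · have hq' := Set.Ioo_subset_Icc_self hq
      filter_upwards [h.tendsto_frequency ha.1.le
        (MeasurableSet.univ.prod (hmeas q hq'))] with ω hω _
      rw [h.prob_rejected ha (hmeas q hq') (hsub q hq') hq'.1 (hvol q hq')] at hω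
      simpa only [numRejected_eq_sum_pair (θ := θ)] using hω
    · exact ae_of_all _ fun _ hq' => absurd hq' hq
  have hS : ∀ᵐ ω ∂P, ∀ q : ℚ, (q : ℝ) ∈ Set.Ioo (0 : ℝ) 1 →
      Tendsto (fun n : ℕ => numTrulyRejected θ ξ D n q ω / n) atTop
        (𝓝 (a * (densityLaw g).real (D q))) := by
    refine ae_all_iff.2 fun q => ?_
    by_cases hq : (q : ℝ) ∈ Set.Ioo (0 : ℝ) 1
    · have hq' := Set.Ioo_subset_Icc_self hq
      filter_upwards [h.tendsto_frequency ha.1.le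
        ((measurableSet_singleton true).prod (hmeas q hq'))] with ω hω _
      rwa [h.prob_truly_rejected ha (hmeas q hq')] at hω
    · exact ae_of_all _ fun _ hq' => absurd hq' hq
  have hN := h.tendsto_frequency ha.1.le
    ((measurableSet_singleton true).prod (MeasurableSet.univ (α := Fin K → ℝ)))
  rw [h.prob_truly_rejected ha MeasurableSet.univ, probReal_univ, mul_one] at hN
  have hG : ContinuousAt (fun t => (densityLaw g).real (D t)) t :=
    hcont.continuousAt (Icc_mem_nhds ht.1 ht.2)
  filter_upwards [hR, hS, hN, hτ] with ω hRω hSω hNω hτω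
  have hτI : ∀ k, threshold ξ D α (ns k) ω ∈ Set.Icc (0 : ℝ) 1 := fun k =>
    (threshold_mem hα hmono _ ω).1
  refine ⟨?_, ?_, ?_⟩
  · refine tendsto_of_monotone_of_rat
      (R := fun k t => numRejected ξ D (ns k) t ω / ns k)
      (F := fun t => (1 - a) * t + a * (densityLaw g).real (D t)) (fun k s hs u hu hsu => ?_)
      hτI ht (by fun_prop) (fun q hq => (hRω q hq).comp hns) hτω
    exact div_le_div_of_nonneg_right (numRejected_monotoneOn hmono _ ω hs hu hsu)
      (Nat.cast_nonneg _)
  · refine tendsto_of_monotone_of_rat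
      (R := fun k t => numTrulyRejected θ ξ D (ns k) t ω / ns k)
      (F := fun t => a * (densityLaw g).real (D t)) (fun k s hs u hu hsu => ?_)
      hτI ht (by fun_prop) (fun q hq => (hSω q hq).comp hns) hτω
    exact div_le_div_of_nonneg_right (numTrulyRejected_monotoneOn hmono _ ω hs hu hsu)
      (Nat.cast_nonneg _)
  · simp only [natCast_sub_numTrueNulls (ξ := ξ)]
    exact hNω.comp hns

/-- The limit `t` of the thresholds solves `t / α = P (ξ ∈ D_t)`. -/
lemma IsRandomEffectsModel.limit_threshold_eq (h : IsRandomEffectsModel P a g θ ξ)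
    (ha : a ∈ Set.Ioo (0 : ℝ) 1) (hα : 0 < α)
    (hmeas : ∀ t ∈ Set.Icc (0 : ℝ) 1, MeasurableSet (D t))
    (hsub : ∀ t ∈ Set.Icc (0 : ℝ) 1, D t ⊆ cube K)
    (hvol : ∀ t ∈ Set.Icc (0 : ℝ) 1, volume (D t) = ENNReal.ofReal t)
    (hmono : MonotoneOn D (Set.Icc 0 1))
    (hcont : ContinuousOn (fun t => (densityLaw g).real (D t)) (Set.Icc 0 1))
    (ht : t ∈ Set.Ioo (0 : ℝ) 1)
    (hτ : TendstoInMeasure P (fun n => threshold ξ D α n) atTop (fun _ => t)) :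
    t / α = (1 - a) * t + a * (densityLaw g).real (D t) := by
  -- The claimed identity is deterministic, so a single `ω` from the almost sure event along a
  -- subsequence suffices.
  obtain ⟨ns, hns, hae⟩ := hτ.exists_seq_tendsto_ae
  have hns' := hns.tendsto_atTop
  obtain ⟨ω, ⟨hω, -, -⟩, hτω⟩ :=
    ((h.ae_tendsto_counts ha hα hmeas hsub hvol hmono hcont ht hns' hae).and hae).exists
  -- After division by `n` the `∨ 1` becomes `∨ 1/n` and disappears in the limit.
  have hinv : Tendsto (fun k => (1 : ℝ) / ns k) atTop (𝓝 0) :=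
    tendsto_one_div_atTop_nhds_zero_nat.comp hns'
  have hmax := hω.max hinv
  have hp := h.isProbabilityMeasure_densityLaw ha
  have hnonneg : 0 ≤ (1 - a) * t + a * (densityLaw g).real (D t) := by
    have := sub_nonneg.2 ha.2.le
    have := ha.1.le
    have := ht.1.le
    positivity
  rw [max_eq_left hnonneg] at hmax
  refine tendsto_nhds_unique ((hτω.div_const α).congr' ?_) hmax
  filter_upwards [hτω.eventually (gt_mem_nhds ht.2)] with k hk
  rw [threshold_div_eq hα hmono _ ω hk, max_div_div_right (Nat.cast_nonneg _)]

/-- The power converges to `G (D_t)`, where `t` is the limit of the thresholds. -/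
lemma IsRandomEffectsModel.tendsto_power (h : IsRandomEffectsModel P a g θ ξ)
    (ha : a ∈ Set.Ioo (0 : ℝ) 1) (hα : 0 < α)
    (hmeas : ∀ t ∈ Set.Icc (0 : ℝ) 1, MeasurableSet (D t))
    (hsub : ∀ t ∈ Set.Icc (0 : ℝ) 1, D t ⊆ cube K)
    (hvol : ∀ t ∈ Set.Icc (0 : ℝ) 1, volume (D t) = ENNReal.ofReal t)
    (hmono : MonotoneOn D (Set.Icc 0 1))
    (hcont : ContinuousOn (fun t => (densityLaw g).real (D t)) (Set.Icc 0 1))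
    (ht : t ∈ Set.Ioo (0 : ℝ) 1)
    (hτ : TendstoInMeasure P (fun n => threshold ξ D α n) atTop (fun _ => t)) :
    Tendsto (fun n => power P θ ξ D α n) atTop (𝓝 ((densityLaw g).real (D t))) := by
  -- Every subsequence has a further one along which the thresholds converge almost surely; the
  -- integrand lies in `[0, 1]`, so dominated convergence applies.
  refine Filter.tendsto_of_subseq_tendsto fun ms hms => ?_
  have hτ' : TendstoInMeasure P (fun k => threshold ξ D α (ms k)) atTop (fun _ => t) :=
    fun δ hδ => (hτ δ hδ).comp hms
  obtain ⟨ks, hks, hae⟩ := hτ'.exists_seq_tendsto_ae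
  refine ⟨ks, ?_⟩
  have hns : Tendsto (fun k => ms (ks k)) atTop atTop := hms.comp hks.tendsto_atTop
  have hcounts := h.ae_tendsto_counts ha hα hmeas hsub hvol hmono hcont ht hns hae
  have hlim : ∫ _, (densityLaw g).real (D t) ∂P = (densityLaw g).real (D t) := by simp
  simp only [power, numRejected_sub_numFalselyRejected]
  rw [← hlim]
  refine tendsto_integral_of_dominated_convergence (fun _ => 1) (fun k => ?_)
    (integrable_const _) (fun k => ae_of_all _ fun ω => ?_) ?_
  · exact ((measurable_numTrulyRejected_threshold h.measurable_theta h.measurable_xi hα hmeas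
      hmono _).div ((measurable_const.sub (measurable_numTrueNulls h.measurable_theta _)).max
        measurable_const)).aestronglyMeasurable
  · have hpos : (0 : ℝ) < max ((ms (ks k) : ℝ) - numTrueNulls θ (ms (ks k)) ω) 1 :=
      lt_max_of_lt_right one_pos
    rw [Real.norm_of_nonneg (div_nonneg (numTrulyRejected_nonneg _ _ _) hpos.le),
      div_le_one hpos]
    exact (numTrulyRejected_le _ _ _).trans (le_max_left _ _)
  · filter_upwards [hcounts] with ω ⟨_, hω, hNω⟩
    have hinv : Tendsto (fun k => (1 : ℝ) / ms (ks k)) atTop (𝓝 0) :=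
      tendsto_one_div_atTop_nhds_zero_nat.comp hns
    have hmax := hNω.max hinv
    rw [max_eq_left ha.1.le] at hmax
    have hdiv := hω.div hmax ha.1.ne'
    rw [mul_div_cancel_left₀ _ ha.1.ne'] at hdiv
    refine hdiv.congr' ?_
    filter_upwards [hns.eventually (eventually_gt_atTop 0)] with k hk
    have hk' : (0 : ℝ) < ms (ks k) := Nat.cast_pos.2 hk
    simp only [Pi.div_apply]
    rw [max_div_div_right hk'.le, div_div_div_cancel_right₀ hk'.ne']

end Limit

end MultiFDR

namespace MultiFDR

/-! ### The regions `Γ_u` and their regularization -/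

section Regions

variable {K : ℕ} {ν : Fin K → ℝ} {ε : ℝ}

lemma measurableSet_cube : MeasurableSet (cube K) := measurableSet_Icc

lemma isCompact_cube : IsCompact (cube K) := isCompact_Icc

lemma volume_cube : volume (cube K) = 1 := by
  simp [cube, Real.volume_Icc_pi]

lemma volume_ne_top_of_subset_cube {s : Set (Fin K → ℝ)} (hs : s ⊆ cube K) : volume s ≠ ∞ :=
  ne_top_of_le_ne_top (by rw [volume_cube]; exact ENNReal.one_ne_top) (measure_mono hs)

lemma continuous_weightedSum (ν : Fin K → ℝ) (hε : 0 < ε) : Continuous (weightedSum ν ε) :=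
  continuous_finsetSum _ fun k _ =>
    continuous_const.mul ((Real.continuous_rpow_const hε.le).comp (continuous_apply k))

lemma weightedSum_nonneg (hν : ∀ k, 0 ≤ ν k) {x : Fin K → ℝ} (hx : 0 ≤ x) :
    0 ≤ weightedSum ν ε x :=
  Finset.sum_nonneg fun k _ => mul_nonneg (hν k) (Real.rpow_nonneg (hx k) _)

lemma mul_rpow_le_weightedSum (hν : ∀ k, 0 ≤ ν k) {x : Fin K → ℝ} (hx : 0 ≤ x) (k : Fin K) :
    ν k * x k ^ ε ≤ weightedSum ν ε x :=
  Finset.single_le_sum (f := fun k => ν k * x k ^ ε)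
    (fun k _ => mul_nonneg (hν k) (Real.rpow_nonneg (hx k) _)) (Finset.mem_univ k)

lemma weightedSum_smul (ν : Fin K → ℝ) {s : ℝ} (hs : 0 ≤ s) {x : Fin K → ℝ} (hx : 0 ≤ x) :
    weightedSum ν ε (s • x) = s ^ ε * weightedSum ν ε x := by
  simp only [weightedSum, Finset.mul_sum, Pi.smul_apply, smul_eq_mul]
  refine Finset.sum_congr rfl fun k _ => ?_
  rw [Real.mul_rpow hs (hx k)]
  ring

lemma measurableSet_ellRegion (ν : Fin K → ℝ) (hε : 0 < ε) (u : ℝ) :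
    MeasurableSet (ellRegion ν ε u) :=
  measurableSet_cube.inter
    ((isClosed_Iic (a := u)).preimage (continuous_weightedSum ν hε)).measurableSet

lemma ellRegion_subset_cube (ν : Fin K → ℝ) (ε u : ℝ) : ellRegion ν ε u ⊆ cube K :=
  fun _ hx => hx.1

lemma ellRegion_mono (ν : Fin K → ℝ) (ε : ℝ) : Monotone (ellRegion ν ε) :=
  fun _ _ huv _ hx => ⟨hx.1, hx.2.trans huv⟩

lemma ellRegion_sum (hν : ∀ k, 0 ≤ ν k) (hε : 0 < ε) :
    ellRegion ν ε (∑ k, ν k) = cube K := by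
  refine Set.Subset.antisymm (ellRegion_subset_cube _ _ _) fun x hx => ⟨hx, ?_⟩
  refine Finset.sum_le_sum fun k _ => ?_
  exact mul_le_of_le_one_right (hν k) (Real.rpow_le_one (hx.1 k) (hx.2 k) hε.le)

/-- The level sets of the weighted sum are null sets. -/
lemma volume_level_eq_zero (hε : 0 < ε) {j : Fin K} (hj : 0 < ν j) (u : ℝ) :
    volume {x ∈ cube K | weightedSum ν ε x = u} = 0 := by
  -- The weighted sum is strictly increasing in `x_j`, so the translates of a level set by distinct
  -- multiples of the `j`-th basis vector are disjoint.
  refine Measure.addHaar_eq_zero_of_disjoint_translates volume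
    (fun n : ℕ => Pi.single j (1 / ((n : ℝ) + 1))) ?_ ?_ ?_
  · refine isBounded_iff_forall_norm_le.2 ⟨1, ?_⟩
    rintro _ ⟨n, rfl⟩
    rw [Pi.norm_single, Real.norm_of_nonneg (by positivity), div_le_one (by positivity)]
    linarith [(Nat.cast_nonneg n : (0 : ℝ) ≤ n)]
  · intro n m hnm
    refine Set.disjoint_left.2 ?_
    simp only [Set.singleton_add, Set.mem_image, not_exists, not_and]
    rintro _ ⟨x, ⟨hx, hxu⟩, rfl⟩ y ⟨hy, hyu⟩ hxy
    refine hnm ?_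
    have hne : ∀ k, k ≠ j → y k = x k := fun k hk => by
      have := congrFun hxy k
      simpa [hk] using this
    have hsum : weightedSum ν ε y - weightedSum ν ε x = ν j * y j ^ ε - ν j * x j ^ ε := by
      rw [weightedSum, weightedSum, ← Finset.sum_sub_distrib]
      refine Finset.sum_eq_single j (fun k _ hk => ?_) (by simp)
      rw [hne k hk, sub_self]
    rw [hxu, hyu, sub_self, ← mul_sub] at hsum
    have hpow : y j ^ ε = x j ^ ε := by
      rcases mul_eq_zero.1 hsum.symm with h | h
      · exact absurd h hj.ne'
      · linarith
    have hxj : y j = x j := (Real.rpow_left_inj (hy.1 j) (hx.1 j) hε.ne').1 hpow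
    have := congrFun hxy j
    simp only [Pi.add_apply, Pi.single_eq_same, hxj, add_left_inj] at this
    field_simp at this
    exact_mod_cast (add_right_cancel this)
  · exact measurableSet_cube.inter
      ((isClosed_singleton (x := u)).preimage (continuous_weightedSum ν hε)).measurableSet

/-- For fixed `x`, the indicator of `weightedSum ν ε x ≤ u` jumps only at `u = weightedSum ν ε x`.
For given `u` this concerns a null set of `x`, so dominated convergence applies. -/
lemma continuous_volume_ellRegion (hε : 0 < ε) {j : Fin K} (hj : 0 < ν j) :
    Continuous fun u => volume.real (ellRegion ν ε u) := by
  have heq : (fun u => volume.real (ellRegion ν ε u)) = fun u =>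
      ∫ x in cube K, (Set.Ici (weightedSum ν ε x)).indicator (fun _ => (1 : ℝ)) u := by
    funext u
    have hm : MeasurableSet {x | weightedSum ν ε x ≤ u} :=
      ((isClosed_Iic (a := u)).preimage (continuous_weightedSum ν hε)).measurableSet
    have h1 : (fun x => (Set.Ici (weightedSum ν ε x)).indicator (fun _ => (1 : ℝ)) u) =
        {x | weightedSum ν ε x ≤ u}.indicator 1 := by
      funext x
      by_cases h : weightedSum ν ε x ≤ u <;> simp [h, Set.indicator]
    rw [h1, integral_indicator_one hm, measureReal_restrict_apply hm, Set.inter_comm]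
    rfl
  rw [heq, continuous_iff_continuousAt]
  intro u
  have : IsFiniteMeasure (volume.restrict (cube K)) :=
    ⟨by rw [Measure.restrict_apply_univ, volume_cube]; exact ENNReal.one_lt_top⟩
  refine continuousAt_of_dominated (bound := fun _ => 1) (Eventually.of_forall fun v => ?_)
    (Eventually.of_forall fun v => ae_of_all _ fun x => ?_) (integrable_const _) ?_
  · have hm : MeasurableSet {x | weightedSum ν ε x ≤ v} :=
      ((isClosed_Iic (a := v)).preimage (continuous_weightedSum ν hε)).measurableSet
    exact (measurable_const.indicator hm : Measurable ({x | weightedSum ν ε x ≤ v}.indicator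
      fun _ => (1 : ℝ))).aestronglyMeasurable
  · by_cases h : weightedSum ν ε x ≤ v <;> simp [h, Set.indicator]
  · have hnull : ∀ᵐ x ∂volume.restrict (cube K), weightedSum ν ε x ≠ u := by
      rw [ae_restrict_iff' measurableSet_cube, ae_iff]
      refine measure_mono_null (fun x hx => ?_) (volume_level_eq_zero hε hj u)
      simpa using hx
    filter_upwards [hnull] with x hx
    rcases lt_or_gt_of_ne hx with h | h
    · refine (continuousAt_const (y := (1 : ℝ))).congr ?_
      filter_upwards [lt_mem_nhds h] with v hv
      simp [Set.indicator, hv.le]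
    · refine (continuousAt_const (y := (0 : ℝ))).congr ?_
      filter_upwards [gt_mem_nhds h] with v hv
      simp [Set.indicator, hv]

lemma volume_real_ellRegion_mono (ν : Fin K → ℝ) (ε : ℝ) :
    Monotone fun u => volume.real (ellRegion ν ε u) := fun _ v huv =>
  measureReal_mono (ellRegion_mono ν ε huv)
    (volume_ne_top_of_subset_cube (ellRegion_subset_cube ν ε v))

/-- The regularized family consists of regions `Γ_u` of the right measure. -/
lemma exists_regularizedEll_eq (hν : ∀ k, 0 ≤ ν k) (hνsum : 0 < ∑ k, ν k) (hε : 0 < ε) {t : ℝ}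
    (ht : t ∈ Set.Icc (0 : ℝ) 1) :
    ∃ u ∈ Set.Icc 0 (∑ k, ν k), volume.real (ellRegion ν ε u) = t ∧
      regularizedEll ν ε t = ellRegion ν ε u := by
  obtain ⟨j, -, hj⟩ := Finset.exists_lt_of_sum_lt (s := Finset.univ) (f := fun _ => (0 : ℝ))
    (g := ν) (by simpa using hνsum)
  have h0 : volume.real (ellRegion ν ε 0) = 0 := by
    have hsub : ellRegion ν ε 0 ⊆ {x ∈ cube K | weightedSum ν ε x = 0} := fun x hx =>
      ⟨hx.1, le_antisymm hx.2 (weightedSum_nonneg hν hx.1.1)⟩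
    rw [measureReal_def, measure_mono_null hsub (volume_level_eq_zero hε hj 0),
      ENNReal.toReal_zero]
  have h1 : volume.real (ellRegion ν ε (∑ k, ν k)) = 1 := by
    rw [ellRegion_sum hν hε, measureReal_def, volume_cube, ENNReal.toReal_one]
  rcases ht.1.eq_or_lt with rfl | ht0
  · refine ⟨0, ⟨le_rfl, hνsum.le⟩, h0, ?_⟩
    rw [regularizedEll, regularization, if_pos le_rfl]
    exact Set.Subset.antisymm (Set.biInter_subset_of_mem ⟨le_rfl, hνsum.le⟩)
      (Set.subset_iInter₂ fun u hu => ellRegion_mono ν ε hu.1)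
  rcases ht.2.eq_or_lt with rfl | ht1
  · refine ⟨_, ⟨hνsum.le, le_rfl⟩, h1, ?_⟩
    rw [regularizedEll, regularization, if_neg (not_le.2 one_pos), if_pos le_rfl,
      ellRegion_sum hν hε]
  -- Existence of a preimage makes `invFunOn` return one; injectivity of the volume function plays
  -- no role.
  · have hex : ∃ u ∈ Set.Icc 0 (∑ k, ν k), volume.real (ellRegion ν ε u) = t :=
      intermediate_value_Icc hνsum.le (continuous_volume_ellRegion hε hj).continuousOn
        (by rw [h0, h1]; exact ht)
    refine ⟨Function.invFunOn (fun u => volume.real (ellRegion ν ε u))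
      (Set.Icc 0 (∑ k, ν k)) t, Function.invFunOn_mem hex, Function.invFunOn_eq hex, ?_⟩
    rw [regularizedEll, regularization, if_neg (not_le.2 ht0), if_neg (not_le.2 ht1)]

lemma regularizedEll_monotoneOn (hν : ∀ k, 0 ≤ ν k) (hνsum : 0 < ∑ k, ν k) (hε : 0 < ε) :
    MonotoneOn (regularizedEll ν ε) (Set.Icc 0 1) := by
  intro s hs t ht hst
  rcases hst.eq_or_lt with rfl | hlt
  · exact le_rfl
  obtain ⟨u, -, hu, hu'⟩ := exists_regularizedEll_eq hν hνsum hε hs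
  obtain ⟨v, -, hv, hv'⟩ := exists_regularizedEll_eq hν hνsum hε ht
  rw [hu', hv']
  refine ellRegion_mono ν ε (not_lt.1 fun hvu => ?_)
  have := volume_real_ellRegion_mono ν ε hvu.le
  dsimp only at this
  linarith

lemma measurableSet_regularizedEll (hν : ∀ k, 0 ≤ ν k) (hνsum : 0 < ∑ k, ν k) (hε : 0 < ε)
    {t : ℝ} (ht : t ∈ Set.Icc (0 : ℝ) 1) : MeasurableSet (regularizedEll ν ε t) := by
  obtain ⟨u, -, -, hu⟩ := exists_regularizedEll_eq hν hνsum hε ht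
  exact hu ▸ measurableSet_ellRegion ν hε u

lemma regularizedEll_subset_cube (hν : ∀ k, 0 ≤ ν k) (hνsum : 0 < ∑ k, ν k) (hε : 0 < ε)
    {t : ℝ} (ht : t ∈ Set.Icc (0 : ℝ) 1) : regularizedEll ν ε t ⊆ cube K := by
  obtain ⟨u, -, -, hu⟩ := exists_regularizedEll_eq hν hνsum hε ht
  exact hu ▸ ellRegion_subset_cube ν ε u

lemma volume_real_regularizedEll (hν : ∀ k, 0 ≤ ν k) (hνsum : 0 < ∑ k, ν k) (hε : 0 < ε)
    {t : ℝ} (ht : t ∈ Set.Icc (0 : ℝ) 1) : volume.real (regularizedEll ν ε t) = t := by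
  obtain ⟨u, -, hu, hu'⟩ := exists_regularizedEll_eq hν hνsum hε ht
  rw [hu', hu]

lemma volume_regularizedEll (hν : ∀ k, 0 ≤ ν k) (hνsum : 0 < ∑ k, ν k) (hε : 0 < ε)
    {t : ℝ} (ht : t ∈ Set.Icc (0 : ℝ) 1) :
    volume (regularizedEll ν ε t) = ENNReal.ofReal t := by
  have h := volume_real_regularizedEll hν hνsum hε ht
  rw [measureReal_def] at h
  rw [← ENNReal.ofReal_toReal
    (volume_ne_top_of_subset_cube (regularizedEll_subset_cube hν hνsum hε ht)), h]

lemma volume_real_ellRegion_pos (hε : 0 < ε) (hν : ∀ k, 0 ≤ ν k) {u : ℝ}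
    (hu : 0 < u) : 0 < volume.real (ellRegion ν ε u) := by
  have hlim : Tendsto (fun c : ℝ => c ^ ε * ∑ k, ν k) (𝓝[>] 0) (𝓝 0) := by
    have := ((Real.continuous_rpow_const hε.le).tendsto 0).mul_const (∑ k, ν k)
    rw [Real.zero_rpow hε.ne', zero_mul] at this
    exact this.mono_left nhdsWithin_le_nhds
  obtain ⟨c, ⟨hcu, hc1⟩, hc0⟩ := ((hlim.eventually (gt_mem_nhds hu)).and
    (nhdsWithin_le_nhds (gt_mem_nhds one_pos)) |>.and self_mem_nhdsWithin).exists
  have hc0 : 0 < c := hc0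
  -- A small cube of side `c` with `c ^ ε * ∑ ν_k < u` fits inside the region.
  have hsub : Set.Icc (0 : Fin K → ℝ) (fun _ => c) ⊆ ellRegion ν ε u := by
    intro x hx
    refine ⟨⟨hx.1, fun k => (hx.2 k).trans hc1.le⟩, le_trans ?_ hcu.le⟩
    rw [weightedSum, Finset.mul_sum]
    refine Finset.sum_le_sum fun k _ => ?_
    rw [mul_comm]
    exact mul_le_mul_of_nonneg_right (Real.rpow_le_rpow (hx.1 k) (hx.2 k) hε.le) (hν k)
  refine lt_of_lt_of_le ?_ (measureReal_mono hsub
    (volume_ne_top_of_subset_cube (ellRegion_subset_cube ν ε u)))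
  rw [measureReal_def, Real.volume_Icc_pi]
  simp [ENNReal.toReal_ofReal hc0.le, pow_pos hc0]

end Regions

/-! ### The deficit `g 0 * ℓ(s) - G(s)` -/

section Deficit

variable {K : ℕ} {g : (Fin K → ℝ) → ℝ} {γ : Fin K → ℝ} {ε : ℝ}

lemma IsFalseNullDensity.integrableOn (hg : IsFalseNullDensity g γ ε) :
    IntegrableOn g (cube K) :=
  hg.continuousOn.integrableOn_compact isCompact_cube

lemma integrableOn_const_of_subset_cube {s : Set (Fin K → ℝ)} (hs : s ⊆ cube K) (c : ℝ) :
    IntegrableOn (fun _ => c) s :=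
  integrableOn_const (volume_ne_top_of_subset_cube hs)

lemma IsFalseNullDensity.densityLaw_real (hg : IsFalseNullDensity g γ ε)
    {s : Set (Fin K → ℝ)} (hs : MeasurableSet s) (hsub : s ⊆ cube K) :
    (densityLaw g).real s = ∫ x in s, g x := by
  have hnn : 0 ≤ᵐ[volume.restrict s] g :=
    (ae_restrict_iff' hs).2 (ae_of_all _ fun x hx => hg.nonneg x (hsub hx))
  rw [measureReal_def, densityLaw, withDensity_apply _ hs, Measure.restrict_restrict hs,
    Set.inter_eq_left.2 hsub, ← ofReal_integral_eq_lintegral_ofReal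
      (hg.integrableOn.mono_set hsub) hnn, ENNReal.toReal_ofReal (integral_nonneg_of_ae hnn)]

/-- The deficit `g 0 * ℓ(s) - G(s)` as an integral. -/
lemma IsFalseNullDensity.deficit_eq (hg : IsFalseNullDensity g γ ε)
    {s : Set (Fin K → ℝ)} (hs : MeasurableSet s) (hsub : s ⊆ cube K) :
    g 0 * volume.real s - (densityLaw g).real s = ∫ x in s, (g 0 - g x) := by
  rw [integral_sub (integrableOn_const_of_subset_cube hsub _) (hg.integrableOn.mono_set hsub),
    hg.densityLaw_real hs hsub, setIntegral_const, smul_eq_mul, mul_comm]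

lemma IsFalseNullDensity.le_zero_value (hg : IsFalseNullDensity g γ ε) {x : Fin K → ℝ}
    (hx : x ∈ cube K) : g x ≤ g 0 := by
  rcases eq_or_ne x 0 with rfl | h
  · exact le_rfl
  · exact (hg.lt_zero_value x hx h).le

lemma IsFalseNullDensity.zero_value_pos (hg : IsFalseNullDensity g γ ε) (hK : 0 < K) :
    0 < g 0 := by
  have h1 : (1 : Fin K → ℝ) ∈ cube K := ⟨zero_le_one, le_rfl⟩
  refine (hg.nonneg 1 h1).trans_lt (hg.lt_zero_value 1 h1 fun h => ?_)
  simpa using congrFun h ⟨0, hK⟩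

lemma IsFalseNullDensity.deficit_mono (hg : IsFalseNullDensity g γ ε)
    {s s' : Set (Fin K → ℝ)} (hs' : MeasurableSet s') (hsub' : s' ⊆ cube K) (hss : s ⊆ s') :
    ∫ x in s, (g 0 - g x) ≤ ∫ x in s', (g 0 - g x) :=
  setIntegral_mono_set ((integrableOn_const_of_subset_cube hsub' _).sub
    (hg.integrableOn.mono_set hsub'))
    ((ae_restrict_iff' hs').2 (ae_of_all _ fun _ hx => sub_nonneg.2 (hg.le_zero_value (hsub' hx))))
    (Eventually.of_forall hss)

/-- A set of positive measure has a positive integral of a function positive off the origin. -/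
lemma setIntegral_pos_of_pos_off_zero (hK : 0 < K) {f : (Fin K → ℝ) → ℝ} {s : Set (Fin K → ℝ)}
    (hs : MeasurableSet s) (hvol : 0 < volume s) (hint : IntegrableOn f s)
    (hnonneg : ∀ x ∈ s, 0 ≤ f x) (hpos : ∀ x ∈ s, x ≠ 0 → 0 < f x) : 0 < ∫ x in s, f x := by
  have : Nonempty (Fin K) := ⟨⟨0, hK⟩⟩
  rw [setIntegral_pos_iff_support_of_nonneg_ae
    ((ae_restrict_iff' hs).2 (ae_of_all _ hnonneg)) hint]
  have hsub : s \ {0} ⊆ Function.support f ∩ s := fun x hx => ⟨(hpos x hx.1 hx.2).ne', hx.1⟩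
  refine lt_of_lt_of_le ?_ (measure_mono hsub)
  rwa [measure_sdiff_null (measure_singleton _)]

lemma IsFalseNullDensity.deficit_pos (hg : IsFalseNullDensity g γ ε) (hK : 0 < K)
    {s : Set (Fin K → ℝ)} (hs : MeasurableSet s) (hsub : s ⊆ cube K) (hvol : 0 < volume s) :
    0 < ∫ x in s, (g 0 - g x) :=
  setIntegral_pos_of_pos_off_zero hK hs hvol
    ((integrableOn_const_of_subset_cube hsub _).sub (hg.integrableOn.mono_set hsub))
    (fun _ hx => sub_nonneg.2 (hg.le_zero_value (hsub hx)))
    fun x hx h0 => sub_pos.2 (hg.lt_zero_value x (hsub hx) h0)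

/-- If some weight vanishes, the deficit of `Γ_u` is at least linear in its measure. -/
lemma IsFalseNullDensity.exists_mul_volume_le_deficit (hg : IsFalseNullDensity g γ ε)
    {ν : Fin K → ℝ} {j : Fin K} (hj : ν j = 0) :
    ∃ c > 0, ∀ u, c * volume.real (ellRegion ν ε u) ≤ ∫ x in ellRegion ν ε u, (g 0 - g x) := by
  -- On `H` the density stays below a value `g y < g 0` by compactness, and `H` contains at least
  -- half of the volume of each `Γ_u`.
  set H : Set (Fin K → ℝ) := {x | 1 / 2 ≤ x j}
  have hHc : IsClosed H := isClosed_le continuous_const (continuous_apply j)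
  have hne : (cube K ∩ H).Nonempty := ⟨1, ⟨zero_le_one, le_rfl⟩, by simp [H]; norm_num⟩
  obtain ⟨y, hy, hmax⟩ := (isCompact_cube.inter_right hHc).exists_isMaxOn hne
    (hg.continuousOn.mono Set.inter_subset_left)
  have hy0 : y ≠ 0 := by
    rintro rfl
    have : (1 : ℝ) / 2 ≤ 0 := hy.2
    norm_num at this
  refine ⟨(g 0 - g y) / 2, half_pos (sub_pos.2 (hg.lt_zero_value y hy.1 hy0)), fun u => ?_⟩
  set E := ellRegion ν ε u
  have hE : MeasurableSet E := measurableSet_ellRegion ν hg.eps_pos u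
  have hEc : E ⊆ cube K := ellRegion_subset_cube ν ε u
  have hEH : MeasurableSet (E ∩ H) := hE.inter hHc.measurableSet
  -- Reflection of the `j`-th coordinate, `x_j ↦ 1 - x_j`. It preserves volume, and also `Γ_u`
  -- because `ν_j = 0`.
  let T : (Fin K → ℝ) → Fin K → ℝ := fun x k => (if k = j then fun r : ℝ => 1 - r else id) (x k)
  have hT : MeasurePreserving T volume volume := by
    refine volume_preserving_pi (f := fun k => if k = j then fun r : ℝ => 1 - r else id)
      fun k => ?_
    by_cases hk : k = j
    · simpa only [hk, if_true] using Measure.measurePreserving_sub_left volume (1 : ℝ)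
    · simpa only [hk, if_false] using MeasurePreserving.id volume
  have hTE : E \ H ⊆ T ⁻¹' (E ∩ H) := by
    rintro x ⟨hx, hxH⟩
    have hxj : x j < 1 / 2 := not_le.1 hxH
    have hTj : T x j = 1 - x j := by simp [T]
    have hTk : ∀ k, k ≠ j → T x k = x k := fun k hk => by simp [T, hk]
    refine ⟨⟨⟨fun k => ?_, fun k => ?_⟩, ?_⟩, ?_⟩
    · by_cases hk : k = j
      · subst hk; rw [hTj]; have := hx.1.2 k; simp only [Pi.one_apply, Pi.zero_apply] at *; linarith
      · rw [hTk k hk]; exact hx.1.1 k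
    · by_cases hk : k = j
      · subst hk; rw [hTj]; have := hx.1.1 k; simp only [Pi.one_apply, Pi.zero_apply] at *; linarith
      · rw [hTk k hk]; exact hx.1.2 k
    · have : weightedSum ν ε (T x) = weightedSum ν ε x := by
        refine Finset.sum_congr rfl fun k _ => ?_
        by_cases hk : k = j
        · subst hk; rw [hj]; simp
        · rw [hTk k hk]
      rw [this]; exact hx.2
    · change 1 / 2 ≤ T x j
      rw [hTj]; linarith
  have hvol : volume.real E ≤ 2 * volume.real (E ∩ H) := by
    have h1 : volume.real (E \ H) ≤ volume.real (E ∩ H) := by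
      have h2 : volume (E \ H) ≤ volume (E ∩ H) := by
        rw [← hT.measure_preimage hEH.nullMeasurableSet]
        exact measure_mono hTE
      exact ENNReal.toReal_mono
        (volume_ne_top_of_subset_cube (Set.inter_subset_left.trans hEc)) h2
    have h3 := measureReal_inter_add_sdiff₀ (μ := volume) (s := E)
      hHc.measurableSet.nullMeasurableSet (volume_ne_top_of_subset_cube hEc)
    linarith
  have hsubEH : E ∩ H ⊆ cube K := Set.inter_subset_left.trans hEc
  calc (g 0 - g y) / 2 * volume.real E
      ≤ (g 0 - g y) / 2 * (2 * volume.real (E ∩ H)) :=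
        mul_le_mul_of_nonneg_left hvol
          (half_pos (sub_pos.2 (hg.lt_zero_value y hy.1 hy0))).le
    _ = ∫ _ in E ∩ H, (g 0 - g y) := by rw [setIntegral_const, smul_eq_mul]; ring
    _ ≤ ∫ x in E ∩ H, (g 0 - g x) :=
        setIntegral_mono_on (integrableOn_const_of_subset_cube hsubEH _)
          ((integrableOn_const_of_subset_cube hsubEH _).sub (hg.integrableOn.mono_set hsubEH))
          hEH fun x hx => sub_le_sub_left (hmax ⟨hEc hx.1, hx.2⟩) _
    _ ≤ ∫ x in E, (g 0 - g x) := hg.deficit_mono hE hEc Set.inter_subset_left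

end Deficit

end MultiFDR

namespace MultiFDR

/-! ### The deficit of the regularized family near the origin -/

section Asymptotics

open scoped Pointwise

variable {K : ℕ} {g : (Fin K → ℝ) → ℝ} {γ ν : Fin K → ℝ} {ε : ℝ}

/-- The body `{x ≥ 0 : ν' x^ε ≤ 1}`. -/
def ellBody (ν : Fin K → ℝ) (ε : ℝ) : Set (Fin K → ℝ) :=
  {x | 0 ≤ x ∧ weightedSum ν ε x ≤ 1}

lemma measurableSet_ellBody (ν : Fin K → ℝ) (hε : 0 < ε) : MeasurableSet (ellBody ν ε) :=
  (isClosed_Ici.inter (isClosed_Iic.preimage (continuous_weightedSum ν hε))).measurableSet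

lemma exists_norm_le_of_mem_ellBody (hν : ∀ k, 0 < ν k) (hε : 0 < ε) :
    ∃ C > 0, ∀ x ∈ ellBody ν ε, ‖x‖ ≤ C := by
  have hnn : ∀ k, 0 ≤ (1 / ν k) ^ (1 / ε) := fun k =>
    Real.rpow_nonneg (one_div_nonneg.2 (hν k).le) _
  -- The sum dominates each bound `x_k ≤ (1/ν_k)^(1/ε)`; the `+ 1` makes the constant positive even
  -- for `K = 0`.
  refine ⟨∑ k, (1 / ν k) ^ (1 / ε) + 1,
    add_pos_of_nonneg_of_pos (Finset.sum_nonneg fun k _ => hnn k) one_pos, fun x hx => ?_⟩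
  refine (pi_norm_le_iff_of_nonneg (add_nonneg (Finset.sum_nonneg fun k _ => hnn k)
    zero_le_one)).2 fun k => ?_
  rw [Real.norm_of_nonneg (hx.1 k)]
  have h1 : x k ^ ε ≤ 1 / ν k := by
    rw [le_div_iff₀ (hν k), mul_comm]
    exact (mul_rpow_le_weightedSum (fun k => (hν k).le) hx.1 k).trans hx.2
  have h2 : x k ≤ (1 / ν k) ^ (1 / ε) := by
    have := Real.rpow_le_rpow (Real.rpow_nonneg (hx.1 k) _) h1 (one_div_nonneg.2 hε.le)
    rwa [one_div ε, Real.rpow_rpow_inv (hx.1 k) hε.ne', ← one_div ε] at this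
  linarith [Finset.single_le_sum (fun k _ => hnn k) (Finset.mem_univ k)]

lemma volume_ellBody_ne_top (hν : ∀ k, 0 < ν k) (hε : 0 < ε) : volume (ellBody ν ε) ≠ ∞ := by
  obtain ⟨C, -, hC⟩ := exists_norm_le_of_mem_ellBody hν hε
  exact (Metric.isBounded_closedBall.subset fun x hx =>
    mem_closedBall_zero_iff.2 (hC x hx)).measure_lt_top.ne

lemma volume_real_ellBody_pos (hν : ∀ k, 0 < ν k) (hε : 0 < ε) :
    0 < volume.real (ellBody ν ε) :=
  (volume_real_ellRegion_pos hε (fun k => (hν k).le) one_pos).trans_le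
    (measureReal_mono (fun _ hx => ⟨hx.1.1, hx.2⟩) (volume_ellBody_ne_top hν hε))

/-- Homogeneity of the weighted sum. The constraint `x_k ≤ 1` is inactive at this scale, as `ν_k
x_k^ε ≤ s^ε ≤ ν_k`. -/
lemma ellRegion_eq_smul_ellBody (hν : ∀ k, 0 < ν k) (hε : 0 < ε) {s : ℝ} (hs : 0 < s)
    (hsν : ∀ k, s ^ ε ≤ ν k) : ellRegion ν ε (s ^ ε) = s • ellBody ν ε := by
  have hsε : 0 < s ^ ε := Real.rpow_pos_of_pos hs _
  ext x
  rw [Set.mem_smul_set_iff_inv_smul_mem₀ hs.ne']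
  constructor
  · rintro ⟨hx, hxs⟩
    refine ⟨smul_nonneg (inv_nonneg.2 hs.le) hx.1, ?_⟩
    rw [weightedSum_smul ν (inv_nonneg.2 hs.le) hx.1, Real.inv_rpow hs.le,
      inv_mul_le_iff₀ hsε, mul_one]
    exact hxs
  · rintro ⟨hx, hxs⟩
    have hx0 : 0 ≤ x := by
      have := smul_nonneg hs.le hx
      rwa [smul_inv_smul₀ hs.ne'] at this
    rw [weightedSum_smul ν (inv_nonneg.2 hs.le) hx0, Real.inv_rpow hs.le,
      inv_mul_le_iff₀ hsε, mul_one] at hxs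
    refine ⟨⟨hx0, fun k => ?_⟩, hxs⟩
    by_contra! hk
    have h1 : ν k * x k ^ ε ≤ ν k * 1 := by
      rw [mul_one]
      exact (mul_rpow_le_weightedSum (fun k => (hν k).le) hx0 k).trans (hxs.trans (hsν k))
    have h2 : 1 < x k ^ ε := Real.one_lt_rpow hk hε
    exact absurd (le_of_mul_le_mul_left h1 (hν k)) (not_le.2 h2)

lemma eventually_rpow_le (hν : ∀ k, 0 < ν k) (hε : 0 < ε) :
    ∀ᶠ s : ℝ in 𝓝[>] 0, ∀ k, s ^ ε ≤ ν k := by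
  refine eventually_all.2 fun k => ?_
  have h := (Real.continuous_rpow_const hε.le).tendsto 0
  rw [Real.zero_rpow hε.ne'] at h
  filter_upwards [(h.mono_left nhdsWithin_le_nhds).eventually (gt_mem_nhds (hν k))] with s hs
  exact hs.le

lemma smul_mem_cube (hν : ∀ k, 0 < ν k) (hε : 0 < ε) {s : ℝ} (hs : 0 < s)
    (hsν : ∀ k, s ^ ε ≤ ν k) {x : Fin K → ℝ} (hx : x ∈ ellBody ν ε) : s • x ∈ cube K :=
  ellRegion_subset_cube ν ε _
    ((ellRegion_eq_smul_ellBody hν hε hs hsν).symm ▸ Set.smul_mem_smul_set hx)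

/-- The rescaled deficit of `s • B` converges to the integral of `γ' x^ε` over the body `B`. -/
lemma IsFalseNullDensity.tendsto_rescaled_deficit (hg : IsFalseNullDensity g γ ε)
    (hν : ∀ k, 0 < ν k) :
    Tendsto (fun s : ℝ => ∫ x in ellBody ν ε, (g 0 - g (s • x)) / s ^ ε) (𝓝[>] 0)
      (𝓝 (∫ x in ellBody ν ε, g 0 * weightedSum γ ε x)) := by
  have hε := hg.eps_pos
  obtain ⟨C, hC0, hC⟩ := exists_norm_le_of_mem_ellBody hν hε
  obtain ⟨r, hgr, hr⟩ := hg.expansion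
  have hBm := measurableSet_ellBody ν hε
  have hfin : IsFiniteMeasure (volume.restrict (ellBody ν ε)) :=
    ⟨by rw [Measure.restrict_apply_univ]; exact (volume_ellBody_ne_top hν hε).lt_top⟩
  have hform : ∀ s : ℝ, 0 < s → (∀ k, s ^ ε ≤ ν k) → ∀ x ∈ ellBody ν ε,
      (g 0 - g (s • x)) / s ^ ε = g 0 * weightedSum γ ε x - g 0 * (r (s • x) / s ^ ε) := by
    intro s hs hsν x hx
    have hsε : s ^ ε ≠ 0 := (Real.rpow_pos_of_pos hs _).ne'
    rw [hgr _ (smul_mem_cube hν hε hs hsν hx), weightedSum_smul γ hs.le hx.1]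
    field_simp
    ring
  -- Uniform over the bounded body: `c = 1` provides the dominating constant, and small `c` the
  -- pointwise limit.
  have hsmall : ∀ c > 0, ∀ᶠ s : ℝ in 𝓝[>] 0, ∀ x ∈ ellBody ν ε,
      |r (s • x) / s ^ ε| ≤ c * C ^ ε := by
    intro c hc
    obtain ⟨δ, hδ, hball⟩ := Metric.mem_nhdsWithin_iff.1 (hr.def hc)
    have hlim : Tendsto (fun s : ℝ => s * C) (𝓝[>] 0) (𝓝 0) := by
      have := (continuous_mul_const C).tendsto (0 : ℝ)
      rw [zero_mul] at this
      exact this.mono_left nhdsWithin_le_nhds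
    filter_upwards [eventually_rpow_le hν hε, self_mem_nhdsWithin,
      hlim.eventually (gt_mem_nhds hδ)] with s hsν hs hsδ x hx
    have hs : 0 < s := hs
    have hsε : 0 < s ^ ε := Real.rpow_pos_of_pos hs _
    have hnorm : ‖s • x‖ ≤ s * C := by
      rw [norm_smul, Real.norm_of_nonneg hs.le]
      exact mul_le_mul_of_nonneg_left (hC x hx) hs.le
    have hmem := hball ⟨mem_ball_zero_iff.2 (hnorm.trans_lt hsδ),
      smul_mem_cube hν hε hs hsν hx⟩
    have hmem : ‖r (s • x)‖ ≤ c * ‖‖s • x‖ ^ ε‖ := hmem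
    rw [Real.norm_of_nonneg (Real.rpow_nonneg (norm_nonneg _) _), Real.norm_eq_abs] at hmem
    rw [abs_div, abs_of_pos hsε, div_le_iff₀ hsε]
    calc |r (s • x)| ≤ c * ‖s • x‖ ^ ε := hmem
      _ ≤ c * (s * C) ^ ε := by gcongr
      _ = c * C ^ ε * s ^ ε := by rw [Real.mul_rpow hs.le hC0.le]; ring
  have hCε : 0 < C ^ ε := Real.rpow_pos_of_pos hC0 _
  have hγ : ∀ x ∈ ellBody ν ε, weightedSum γ ε x ≤ (∑ k, γ k) * C ^ ε := by
    intro x hx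
    rw [weightedSum, Finset.sum_mul]
    refine Finset.sum_le_sum fun k _ => mul_le_mul_of_nonneg_left ?_ (hg.gamma_pos k).le
    refine Real.rpow_le_rpow (hx.1 k) ?_ hε.le
    exact (le_abs_self _).trans ((norm_le_pi_norm x k).trans (hC x hx))
  refine tendsto_integral_filter_of_dominated_convergence
    (fun _ => |g 0| * ((∑ k, γ k) * C ^ ε) + |g 0| * (1 * C ^ ε)) ?_ ?_ (integrable_const _) ?_
  · filter_upwards [eventually_rpow_le hν hε, self_mem_nhdsWithin] with s hsν hs
    have hs : 0 < s := hs
    refine ContinuousOn.aestronglyMeasurable ?_ hBm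
    refine (continuousOn_const.sub (hg.continuousOn.comp
      (continuous_const_smul s).continuousOn fun x hx => smul_mem_cube hν hε hs hsν hx)).div_const _
  · filter_upwards [eventually_rpow_le hν hε, self_mem_nhdsWithin, hsmall 1 one_pos]
      with s hsν hs hsr
    refine (ae_restrict_iff' hBm).2 (ae_of_all _ fun x hx => ?_)
    rw [hform s hs hsν x hx]
    refine (norm_sub_le _ _).trans (add_le_add ?_ ?_)
    · have hw := weightedSum_nonneg (ε := ε) (fun k => (hg.gamma_pos k).le) hx.1
      rw [norm_mul, Real.norm_eq_abs, Real.norm_of_nonneg hw]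
      exact mul_le_mul_of_nonneg_left (hγ x hx) (abs_nonneg _)
    · rw [norm_mul, Real.norm_eq_abs, Real.norm_eq_abs]
      exact mul_le_mul_of_nonneg_left (hsr x hx) (abs_nonneg _)
  · refine (ae_restrict_iff' hBm).2 (ae_of_all _ fun x hx => ?_)
    have h0 : Tendsto (fun s : ℝ => r (s • x) / s ^ ε) (𝓝[>] 0) (𝓝 0) := by
      refine Metric.tendsto_nhds.2 fun c hc => ?_
      filter_upwards [hsmall (c / 2 / C ^ ε) (by positivity)] with s hs
      have h := hs x hx
      rw [div_mul_cancel₀ _ hCε.ne'] at h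
      rw [Real.dist_0_eq_abs]
      linarith
    have h1 := (h0.const_mul (g 0)).const_sub (g 0 * weightedSum γ ε x)
    rw [mul_zero, sub_zero] at h1
    refine h1.congr' ?_
    filter_upwards [eventually_rpow_le hν hε, self_mem_nhdsWithin] with s hsν hs
    exact (hform s hs hsν x hx).symm

/-- If all weights are positive, then the deficit `g 0 * t - G (D_t)` of the regularized family
is of exact order `t ^ (1 + ε / K)`. -/
lemma IsFalseNullDensity.exists_tendsto_deficit (hg : IsFalseNullDensity g γ ε) (hK : 0 < K)
    (hν : ∀ k, 0 < ν k) :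
    ∃ C > 0, Tendsto (fun t : ℝ =>
        (g 0 * t - (densityLaw g).real (regularizedEll ν ε t)) / t / t ^ (ε / K))
      (𝓝[>] 0) (𝓝 C) := by
  have hε := hg.eps_pos
  have hK' : (0 : ℝ) < K := Nat.cast_pos.2 hK
  have : Nonempty (Fin K) := ⟨⟨0, hK⟩⟩
  have hν0 : ∀ k, 0 ≤ ν k := fun k => (hν k).le
  have hνsum : 0 < ∑ k, ν k := Finset.sum_pos (fun k _ => hν k) Finset.univ_nonempty
  set b := volume.real (ellBody ν ε)
  have hb : 0 < b := volume_real_ellBody_pos hν hε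
  set I := ∫ x in ellBody ν ε, g 0 * weightedSum γ ε x
  have hIpos : 0 < I := by
    obtain ⟨R, -, hR⟩ := exists_norm_le_of_mem_ellBody hν hε
    refine setIntegral_pos_of_pos_off_zero hK (measurableSet_ellBody ν hε)
      (ENNReal.toReal_pos_iff.1 hb).1 ?_ (fun x hx => ?_) fun x hx hx0 => ?_
    · exact ((continuous_const.mul (continuous_weightedSum γ hε)).continuousOn.integrableOn_compact
        (isCompact_closedBall (0 : Fin K → ℝ) R)).mono_set
          fun x hx => mem_closedBall_zero_iff.2 (hR x hx)
    · exact mul_nonneg (hg.zero_value_pos hK).le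
        (weightedSum_nonneg (fun k => (hg.gamma_pos k).le) hx.1)
    · obtain ⟨k, hk⟩ := Function.ne_iff.1 hx0
      refine mul_pos (hg.zero_value_pos hK) (lt_of_lt_of_le ?_
        (mul_rpow_le_weightedSum (fun k => (hg.gamma_pos k).le) hx.1 k))
      exact mul_pos (hg.gamma_pos k) (Real.rpow_pos_of_pos (lt_of_le_of_ne (hx.1 k) hk.symm) _)
  -- With `t = s^K b`, the deficit is about `s^(K+ε) I`, while `t * t^(ε/K) = s^(K+ε) b^(1+ε/K)`.
  refine ⟨I / (b * b ^ (ε / K)), by positivity, ?_⟩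
  have hs0 : Tendsto (fun t : ℝ => (t / b) ^ (1 / (K : ℝ))) (𝓝[>] 0) (𝓝[>] 0) := by
    refine tendsto_nhdsWithin_iff.2 ⟨?_, ?_⟩
    · have h : Continuous fun t : ℝ => (t / b) ^ (1 / (K : ℝ)) :=
        (Real.continuous_rpow_const (by positivity)).comp (continuous_id.div_const b)
      have h' := h.tendsto 0
      rw [zero_div, Real.zero_rpow (by positivity)] at h'
      exact h'.mono_left nhdsWithin_le_nhds
    · filter_upwards [self_mem_nhdsWithin] with t ht
      have ht : 0 < t := ht
      exact Real.rpow_pos_of_pos (div_pos ht hb) _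
  have hlim := ((hg.tendsto_rescaled_deficit hν).comp hs0).div_const (b * b ^ (ε / K))
  refine hlim.congr' ?_
  -- A fixed scale below which the regions are dilates of the body; small volume forces `u ≤ s₀ ^
  -- ε`.
  obtain ⟨s₀, hs₀ν, hs₀⟩ := ((eventually_rpow_le hν hε).and self_mem_nhdsWithin).exists
  have hs₀ : 0 < s₀ := hs₀
  have hs₀ε : 0 < s₀ ^ ε := Real.rpow_pos_of_pos hs₀ _
  filter_upwards [self_mem_nhdsWithin, nhdsWithin_le_nhds (gt_mem_nhds one_pos),
    nhdsWithin_le_nhds (gt_mem_nhds (volume_real_ellRegion_pos hε hν0 hs₀ε))] with t ht ht1 hts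
  have ht : 0 < t := ht
  obtain ⟨u, huI, hut, hDu⟩ := exists_regularizedEll_eq hν0 hνsum hε ⟨ht.le, ht1.le⟩
  have hus : u ≤ s₀ ^ ε := by
    by_contra! h
    have := volume_real_ellRegion_mono ν ε h.le
    dsimp only at this
    linarith
  have hu0 : 0 < u := by
    refine lt_of_le_of_ne huI.1 fun h => ?_
    have hle : volume (ellRegion ν ε u) = 0 := by
      refine measure_mono_null (fun x hx => ?_)
        (volume_level_eq_zero hε (hν ⟨0, hK⟩) 0)
      exact ⟨hx.1, le_antisymm (hx.2.trans h.symm.le) (weightedSum_nonneg hν0 hx.1.1)⟩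
    rw [measureReal_def, hle, ENNReal.toReal_zero] at hut
    exact ht.ne hut
  set s := u ^ (1 / ε)
  have hs : 0 < s := Real.rpow_pos_of_pos hu0 _
  have hsu : s ^ ε = u := by
    simp only [s, one_div]
    exact Real.rpow_inv_rpow hu0.le hε.ne'
  have hsν : ∀ k, s ^ ε ≤ ν k := fun k => hsu ▸ hus.trans (hs₀ν k)
  have hΓ : ellRegion ν ε u = s • ellBody ν ε := by
    rw [← hsu]
    exact ellRegion_eq_smul_ellBody hν hε hs hsν
  have hsK : 0 < s ^ K := pow_pos hs K
  have htb : t = s ^ K * b := by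
    rw [← hut, hΓ, measureReal_def, Measure.addHaar_smul, ENNReal.toReal_mul,
      Module.finrank_fin_fun, abs_of_pos hsK, ENNReal.toReal_ofReal hsK.le, ← measureReal_def]
  have hst : (t / b) ^ (1 / (K : ℝ)) = s := by
    rw [htb, mul_div_cancel_right₀ _ hb.ne', one_div, Real.pow_rpow_inv_natCast hs.le hK.ne']
  have hdef : g 0 * t - (densityLaw g).real (regularizedEll ν ε t) =
      ∫ x in s • ellBody ν ε, (g 0 - g x) := by
    rw [hDu, ← hΓ, ← hg.deficit_eq (measurableSet_ellRegion ν hε u)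
      (ellRegion_subset_cube ν ε u), hut]
  have hscale := Measure.setIntegral_comp_smul volume (fun x => g 0 - g x) (ellBody ν ε) hs.ne'
  rw [Module.finrank_fin_fun, abs_of_pos (inv_pos.2 hsK), smul_eq_mul] at hscale
  have htp : t ^ (ε / K) = s ^ ε * b ^ (ε / K) := by
    rw [htb, Real.mul_rpow hsK.le hb.le, ← Real.rpow_natCast_mul hs.le,
      mul_div_cancel₀ _ hK'.ne']
  have hsε : 0 < s ^ ε := Real.rpow_pos_of_pos hs _
  have hbε : 0 < b ^ (ε / K) := Real.rpow_pos_of_pos hb _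
  simp only [Function.comp_apply]
  rw [hst, integral_div, hscale, hdef, htp, htb]
  field_simp

end Asymptotics

end MultiFDR

/-! ### ### From the deficits to the ratio of the powers -/

namespace MultiFDR

lemma IsNestedFamily.monotoneOn {K : ℕ} {D : ℝ → Set (Fin K → ℝ)} (hD : IsNestedFamily D) :
    MonotoneOn D (Set.Icc 0 1) := fun s hs t ht hst => by
  rcases hst.eq_or_lt with rfl | h
  · exact le_rfl
  · exact hD.mono s t hs.1 h ht.2

/-- If `δ = A₂ (t₂) = A₁ (t₁)` with `A₂ t` of order `t ^ p` and `A₁ / A₂ → M`, then `t₁ / t₂`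
converges to `(1 / M) ^ (1 / p)`. -/
lemma tendsto_ratio_of_power_law {ι : Type*} {l : Filter ι} {A₁ A₂ : ℝ → ℝ} {δ t₁ t₂ : ι → ℝ}
    {p C : ℝ} {M : ℝ≥0∞} (hp : 0 < p) (hC : 0 < C) (hM : 1 ≤ M)
    (hA₂ : Tendsto (fun t => A₂ t / t ^ p) (𝓝[>] 0) (𝓝 C))
    (hratio : Tendsto (fun t => ENNReal.ofReal (A₁ t / A₂ t)) (𝓝[>] 0) (𝓝 M))
    (ht₁ : Tendsto t₁ l (𝓝[>] 0)) (ht₂ : Tendsto t₂ l (𝓝[>] 0))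
    (hδ : ∀ᶠ i in l, 0 < δ i)
    (h₁ : ∀ᶠ i in l, A₁ (t₁ i) = δ i) (h₂ : ∀ᶠ i in l, A₂ (t₂ i) = δ i) :
    Tendsto (fun i => t₁ i / t₂ i) l (𝓝 ((1 / M) ^ (1 / p)).toReal) := by
  -- Inverting the ratio turns `M = ∞` into the finite limit `0`, so both cases are treated together
  -- in `ℝ`.
  have hMinv : M⁻¹ ≠ ∞ := ENNReal.inv_ne_top.2 (one_pos.trans_le hM).ne'
  have hA₁ : Tendsto (fun i => A₂ (t₁ i) / δ i) l (𝓝 M⁻¹.toReal) := by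
    have h := (ENNReal.tendsto_toReal hMinv).comp
      ((continuous_inv.tendsto M).comp (hratio.comp ht₁))
    -- `ENNReal.ofReal` truncates negative values; along `t₁` both `A₁ = δ` and `A₂` are positive,
    -- so nothing is lost.
    have hpos : ∀ᶠ i in l, 0 < A₂ (t₁ i) := by
      filter_upwards [ht₁.eventually (hA₂.eventually (lt_mem_nhds hC)),
        ht₁.eventually self_mem_nhdsWithin] with i hi hti
      have hti : 0 < t₁ i := hti
      exact (div_pos_iff_of_pos_right (Real.rpow_pos_of_pos hti p)).1 hi
    refine h.congr' ?_
    filter_upwards [hδ, h₁, hpos] with i hδi hi hAi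
    simp only [Function.comp_apply]
    rw [hi, ENNReal.toReal_inv, ENNReal.toReal_ofReal (by positivity), inv_div]
  have hpow : Tendsto (fun i => (t₁ i / t₂ i) ^ p) l (𝓝 M⁻¹.toReal) := by
    -- Since `A₂ (t₂) = δ`, `(t₁/t₂)^p` is `(A₂ (t₂)/t₂^p) * (A₂ (t₁)/δ) / (A₂ (t₁)/t₁^p)`, and the
    -- two factors `C` cancel.
    have h := ((hA₂.comp ht₂).mul hA₁).div (hA₂.comp ht₁) hC.ne'
    rw [mul_div_cancel_left₀ _ hC.ne'] at h
    refine h.congr' ?_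
    filter_upwards [hδ, h₂, ht₁.eventually self_mem_nhdsWithin,
      ht₂.eventually self_mem_nhdsWithin, ht₁.eventually (hA₂.eventually (lt_mem_nhds hC))]
      with i hδi hi hti hti' hAi
    have hti : 0 < t₁ i := hti
    have hti' : 0 < t₂ i := hti'
    have h1 := Real.rpow_pos_of_pos hti p
    have h2 := Real.rpow_pos_of_pos hti' p
    have hA : 0 < A₂ (t₁ i) := (div_pos_iff_of_pos_right h1).1 hAi
    simp only [Function.comp_apply, Pi.div_apply]
    rw [hi, Real.div_rpow hti.le hti'.le]
    field_simp
  have hfin := hpow.rpow_const (p := 1 / p) (Or.inr (by positivity))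
  rw [one_div M, ← ENNReal.toReal_rpow]
  refine hfin.congr' ?_
  filter_upwards [ht₁.eventually self_mem_nhdsWithin,
    ht₂.eventually self_mem_nhdsWithin] with i hti hti'
  have hti : 0 < t₁ i := hti
  have hti' : 0 < t₂ i := hti'
  rw [one_div p]
  exact Real.rpow_rpow_inv (div_pos hti hti').le hp.ne'

end MultiFDR

open MultiFDR

theorem proposition4p3
    {K : ℕ} (hK : 0 < K)
    {Ω : Type*} [MeasurableSpace Ω] (P : Measure Ω) [IsProbabilityMeasure P]
    (a : ℝ) (ha : a ∈ Set.Ioo (0 : ℝ) 1)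
    (g : (Fin K → ℝ) → ℝ) (γ : Fin K → ℝ) (ε : ℝ)
    (hg : MultiFDR.IsFalseNullDensity g γ ε)
    (θ : ℕ → Ω → Bool) (ξ : ℕ → Ω → Fin K → ℝ)
    (hmodel : MultiFDR.IsRandomEffectsModel P a g θ ξ)
    (ν : Fin K → ℝ) (hν : ∀ k, 0 ≤ ν k) (hνsum : 0 < ∑ k, ν k)
    -- the two families of regions
    (D₁ D₂ : ℝ → Set (Fin K → ℝ))
    (hD₁ : MultiFDR.IsNestedFamily D₁)
    (hD₂ : D₂ = MultiFDR.regularizedEll ν ε)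
    (hcont₁ : ContinuousOn (fun t => (MultiFDR.densityLaw g).real (D₁ t)) (Set.Icc 0 1))
    (hcont₂ : ContinuousOn (fun t => (MultiFDR.densityLaw g).real (D₂ t)) (Set.Icc 0 1))
    (T : ℝ) (hT : T ∈ Set.Ioo (0 : ℝ) 1)
    (hlt : ∀ t ∈ Set.Ioc (0 : ℝ) T,
      (MultiFDR.densityLaw g).real (D₁ t) < (MultiFDR.densityLaw g).real (D₂ t))
    -- the limits in probability of the two thresholds, for levels close to `α_*`
    (t₁ t₂ : ℝ → ℝ)
    (ht₁ : ∀ᶠ α in 𝓝[>] (MultiFDR.alphaStar a g), t₁ α ∈ Set.Ioo (0 : ℝ) T ∧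
      TendstoInMeasure P (fun n => MultiFDR.threshold ξ D₁ α n) atTop (fun _ => t₁ α))
    (ht₂ : ∀ᶠ α in 𝓝[>] (MultiFDR.alphaStar a g), t₂ α ∈ Set.Ioo (0 : ℝ) T ∧
      TendstoInMeasure P (fun n => MultiFDR.threshold ξ D₂ α n) atTop (fun _ => t₂ α))
    (ht₁_zero : Tendsto t₁ (𝓝[>] (MultiFDR.alphaStar a g)) (𝓝 0))
    -- `D₁ t` decreases to `{0}` as `t` decreases to `0`
    (hshrink : (⋂ t ∈ Set.Ioc (0 : ℝ) 1, D₁ t) = {0})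
    (M : ℝ≥0∞) (hM : 1 ≤ M)
    (hratio : Tendsto
      (fun t : ℝ => ENNReal.ofReal
        ((g 0 * t - (MultiFDR.densityLaw g).real (D₁ t)) /
          (g 0 * t - (MultiFDR.densityLaw g).real (D₂ t))))
      (𝓝[>] 0) (𝓝 M)) :
    -- the limiting powers exist for levels close to `α_*`, and their ratio converges
    ∃ Pow₁ Pow₂ : ℝ → ℝ,
      (∀ᶠ α in 𝓝[>] (MultiFDR.alphaStar a g),
        Tendsto (fun n => MultiFDR.power P θ ξ D₁ α n) atTop (𝓝 (Pow₁ α)) ∧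
        Tendsto (fun n => MultiFDR.power P θ ξ D₂ α n) atTop (𝓝 (Pow₂ α)) ∧
        0 < Pow₂ α) ∧
      Tendsto (fun α => Pow₁ α / Pow₂ α) (𝓝[>] (MultiFDR.alphaStar a g))
        (𝓝 ((1 / M) ^ ((K : ℝ) / ε)).toReal) := by
  subst hD₂
  have hε := hg.eps_pos
  have hK' : (0 : ℝ) < K := Nat.cast_pos.2 hK
  have hg0 := hg.zero_value_pos hK
  have ha' : 0 < 1 - a := sub_pos.2 ha.2
  have ha0 : 0 < a := ha.1
  set A := alphaStar a g with hAdef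
  have hden : 0 < 1 - a + a * g 0 := by positivity
  have hA : 0 < A := one_div_pos.2 hden
  have hAinv : 1 / A = 1 - a + a * g 0 := by rw [hAdef, alphaStar, one_div_one_div]
  have hgt : ∀ᶠ α in 𝓝[>] A, A < α := self_mem_nhdsWithin
  -- the common slope `G (D_t) / t` at the limiting thresholds
  set c : ℝ → ℝ := fun α => (1 / α - (1 - a)) / a
  have hc_lim : Tendsto c (𝓝[>] A) (𝓝 (g 0)) := by
    have h : ContinuousAt c A := by
      refine ((continuousAt_const.div continuousAt_id hA.ne').sub continuousAt_const).div_const _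
    have hcA : c A = g 0 := by
      simp only [c, hAinv]
      field_simp
      ring
    exact hcA ▸ h.tendsto.mono_left nhdsWithin_le_nhds
  have hc_pos : ∀ᶠ α in 𝓝[>] A, 0 < c α := hc_lim.eventually (lt_mem_nhds hg0)
  have hδ_pos : ∀ᶠ α in 𝓝[>] A, 0 < g 0 - c α := by
    filter_upwards [hgt] with α hα
    have h1 : 1 / α < 1 - a + a * g 0 := hAinv ▸ one_div_lt_one_div_of_lt hA hα
    rw [sub_pos, div_lt_iff₀ ha0]
    linarith
  have hδ_lim : Tendsto (fun α => g 0 - c α) (𝓝[>] A) (𝓝 0) := by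
    simpa using hc_lim.const_sub (g 0)
  have hTI : ∀ {t : ℝ}, t ∈ Set.Ioo 0 T → t ∈ Set.Ioo (0 : ℝ) 1 := fun h =>
    ⟨h.1, h.2.trans hT.2⟩
  have hslope : ∀ {α t x : ℝ}, t / α = (1 - a) * t + a * x → x = t * c α := by
    intro α t x h
    have h1 : a * x = t * (1 / α - (1 - a)) := by rw [mul_sub, mul_one_div, h]; ring
    simp only [c]
    rw [← mul_div_assoc, ← h1, mul_div_cancel_left₀ _ ha0.ne']
  have hD₂meas : ∀ t ∈ Set.Icc (0 : ℝ) 1, MeasurableSet (regularizedEll ν ε t) :=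
    fun t ht => measurableSet_regularizedEll hν hνsum hε ht
  have hD₂sub : ∀ t ∈ Set.Icc (0 : ℝ) 1, regularizedEll ν ε t ⊆ cube K :=
    fun t ht => regularizedEll_subset_cube hν hνsum hε ht
  have hD₂vol : ∀ t ∈ Set.Icc (0 : ℝ) 1, volume (regularizedEll ν ε t) = ENNReal.ofReal t :=
    fun t ht => volume_regularizedEll hν hνsum hε ht
  have hD₂mono := regularizedEll_monotoneOn hν hνsum hε
  have hG₁ : ∀ᶠ α in 𝓝[>] A, (densityLaw g).real (D₁ (t₁ α)) = t₁ α * c α := by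
    filter_upwards [hgt, ht₁] with α hα h
    exact hslope (hmodel.limit_threshold_eq ha (hA.trans hα) hD₁.measurableSet hD₁.subset_cube
      hD₁.volume_eq hD₁.monotoneOn hcont₁ (hTI h.1) h.2)
  have hG₂ : ∀ᶠ α in 𝓝[>] A, (densityLaw g).real (regularizedEll ν ε (t₂ α)) = t₂ α * c α := by
    filter_upwards [hgt, ht₂] with α hα h
    exact hslope (hmodel.limit_threshold_eq ha (hA.trans hα) hD₂meas hD₂sub hD₂vol hD₂mono
      hcont₂ (hTI h.1) h.2)
  have hdeficit : ∀ t ∈ Set.Icc (0 : ℝ) 1, g 0 * t - (densityLaw g).real (regularizedEll ν ε t) =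
      ∫ x in regularizedEll ν ε t, (g 0 - g x) := fun t ht => by
    rw [← hg.deficit_eq (hD₂meas t ht) (hD₂sub t ht), volume_real_regularizedEll hν hνsum hε ht]
  -- all the weights are positive
  have hνpos : ∀ k, 0 < ν k := by
    refine fun j => (hν j).lt_of_ne fun hj => ?_
    -- If `ν_j = 0`, the second deficit at `t₁ α` is at least `κ * t₁ α`, yet it is smaller than the
    -- first, `t₁ α * (g 0 - c α)`. This fails once `g 0 - c α < κ`.
    obtain ⟨κ, hκ, hκle⟩ := hg.exists_mul_volume_le_deficit hj.symm
    obtain ⟨α, ⟨⟨⟨hI, -⟩, hG⟩, hδ⟩⟩ := ((ht₁.and hG₁).and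
      (hδ_lim.eventually (gt_mem_nhds hκ))).exists
    have hI' := Set.Ioo_subset_Icc_self (hTI hI)
    have h1 := hlt _ ⟨hI.1, hI.2.le⟩
    obtain ⟨u, -, hu, hDu⟩ := exists_regularizedEll_eq hν hνsum hε hI'
    have h2 := hκle u
    rw [hu, ← hDu, ← hdeficit _ hI'] at h2
    rw [hG] at h1
    nlinarith [hI.1]
  have ht₁' : Tendsto t₁ (𝓝[>] A) (𝓝[>] 0) :=
    tendsto_nhdsWithin_iff.2 ⟨ht₁_zero, ht₁.mono fun α h => h.1.1⟩
  have ht₂' : Tendsto t₂ (𝓝[>] A) (𝓝[>] 0) := by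
    refine tendsto_nhdsWithin_iff.2 ⟨?_, ht₂.mono fun α h => h.1.1⟩
    refine tendsto_order.2 ⟨fun b hb => ht₂.mono fun α h => hb.trans h.1.1, fun η hη => ?_⟩
    rcases le_or_gt 1 η with h1 | h1
    · exact ht₂.mono fun α h => (hTI h.1).2.trans_le h1
    have hηI : η ∈ Set.Icc (0 : ℝ) 1 := ⟨hη.le, h1.le⟩
    -- If `t₂ α ≥ η`, the deficit there is at least this fixed positive number, although it equals
    -- `t₂ α * (g 0 - c α)`, which is below `g 0 - c α`.
    have hpos : 0 < ∫ x in regularizedEll ν ε η, (g 0 - g x) :=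
      hg.deficit_pos hK (hD₂meas η hηI) (hD₂sub η hηI) (by
        rw [hD₂vol η hηI]; exact ENNReal.ofReal_pos.2 hη)
    filter_upwards [ht₂, hG₂, hδ_pos, hδ_lim.eventually (gt_mem_nhds hpos)]
      with α h hG hδ hδ'
    by_contra! hle
    have hI := Set.Ioo_subset_Icc_self (hTI h.1)
    have hmono := hg.deficit_mono (hD₂meas _ hI) (hD₂sub _ hI) (hD₂mono hηI hI hle)
    rw [← hdeficit _ hI, hG] at hmono
    nlinarith [hI.2]
  obtain ⟨C, hC, hClim⟩ := hg.exists_tendsto_deficit hK hνpos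
  have hlim : Tendsto (fun α => t₁ α / t₂ α) (𝓝[>] A) (𝓝 ((1 / M) ^ ((K : ℝ) / ε)).toReal) := by
    rw [← one_div_div ε (K : ℝ)]
    refine tendsto_ratio_of_power_law
      (A₁ := fun t => (g 0 * t - (densityLaw g).real (D₁ t)) / t)
      (A₂ := fun t => (g 0 * t - (densityLaw g).real (regularizedEll ν ε t)) / t)
      (δ := fun α => g 0 - c α) (div_pos hε hK') hC hM hClim (hratio.congr' ?_) ht₁' ht₂'
      hδ_pos ?_ ?_
    · filter_upwards [self_mem_nhdsWithin] with t ht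
      have ht : 0 < t := ht
      rw [div_div_div_cancel_right₀ ht.ne']
    · filter_upwards [ht₁, hG₁] with α h hG
      rw [hG, mul_comm (g 0), ← mul_sub, mul_div_cancel_left₀ _ h.1.1.ne']
    · filter_upwards [ht₂, hG₂] with α h hG
      rw [hG, mul_comm (g 0), ← mul_sub, mul_div_cancel_left₀ _ h.1.1.ne']
  refine ⟨fun α => (densityLaw g).real (D₁ (t₁ α)),
    fun α => (densityLaw g).real (regularizedEll ν ε (t₂ α)), ?_, hlim.congr' ?_⟩
  · filter_upwards [hgt, ht₁, ht₂, hG₂, hc_pos] with α hα h1 h2 hG hc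
    have hα0 : 0 < α := hA.trans hα
    refine ⟨?_, ?_, ?_⟩
    · exact hmodel.tendsto_power ha hα0 hD₁.measurableSet hD₁.subset_cube
        hD₁.volume_eq hD₁.monotoneOn hcont₁ (hTI h1.1) h1.2
    · exact hmodel.tendsto_power ha hα0 hD₂meas hD₂sub hD₂vol hD₂mono hcont₂ (hTI h2.1) h2.2
    · rw [hG]
      exact mul_pos h2.1.1 hc
  · filter_upwards [hG₁, hG₂, hc_pos] with α h1 h2 hc
    -- The common slope `c α` cancels, leaving the ratio of the thresholds.
    rw [h1, h2, mul_div_mul_right _ _ hc.ne']
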